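/- Let $R>0$, $0\le\nu<1$, $2\sqrt\nu\le\lambda<1+\nu$ and $\lambda>0$, and consider the Pomeransky--Sen'kov doubly-spinning black ring with these parameters, in ring coordinates $(t,x,y,\phi,\psi)$ with $-1\le x\le 1$, $y\le -1$, $(x,y)\ne(-1,-1)$ (the point $(-1,-1)$ is asymptotic infinity) and $\phi,\psi$ $2\pi$-periodic. Put $$H(x,y)=1+\lambda^2-\nu^2+2\lambda\nu(1-x^2)y+2x\lambda(1-y^2\nu^2)+x^2y^2\nu(1-\lambda^2-\nu^2),$$ so that $g_{tt}=-H(y,x)/H(x,y)$. The event horizon is $y=y_h$, where $y_h=\frac{-\lambda+\sqrt{\lambda^2-4\nu}}{2\nu}$ (and $y_h=-1/\lambda$ if $\nu=0$). Describe a spatial section $t=\mathrm{const}$ as a subset of $\mathbb C^2$ through $(r_1e^{i\phi},r_2e^{i\psi})$, with the plane polar radii $r_1=R\sqrt{1-x^2}/(x-y)$ and $r_2=R\sqrt{y^2-1}/(x-y)$; thus the $\phi$-circles collapse on $x=\pm1$ and the $\psi$-circles on the axis $y=-1$. The ergosurface $E$ is the set of points with $y_h\le y\le -1$ and $H(y,x)=0$.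 A closed set is said to enclose a point outside it if the connected component of its complement in $\mathbb C^2$ that contains the point is bounded. 1. (The ergosurface always surrounds the horizon.) There is a continuous function $y_e$ on $[-1,1]$ with $y_e(x)>y_h$ and $H(y_e(x),x)=0$ for all $x$, such that for $x\in[-1,1]$ and $y\in[y_h,-1]$ one has $H(y,x)<0$ if and only if $y<y_e(x)$, and $H(y,x)=0$ if and only if $y=y_e(x)$. (Values $y_e(x)>-1$ are allowed; they give no point of $E$.) Moreover $E$ encloses every point of the horizon. Always $H(-1,1)>0$ and $H(-1,-1)>0$. 2. If $\lambda<1-\nu$, then $H(-1,x)>0$ for all $x\in[-1,1]$, and $E$ is homeomorphic to $S^1\times S^2$. 3. If $\lambda>1-\nu$, then $H(-1,x)<0$ for some $x\in[-1,1]$, and $E$ is homeomorphic to the disjoint union $S^3\sqcup S^3$. More precisely, the parts $E_+=E\cap\{x\ge0\}$ and $E_-=E\cap\{x\le0\}$ are disjoint, have union $E$, and are each homeomorphic to $S^3$; $E_+$ encloses the centre $r_1=r_2=0$ of the ring but no point of the horizon, while $E_-$ encloses every point of the horizon. 4. If $\lambda=1-\nu$, then $E$ pinches on the circle $C=\{x=0,\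 y=-1\}=\{r_1=R,\ r_2=0\}$: $E$ meets the axis $y=-1$ (that is, $r_2=0$) exactly in $C$; there is a continuous surjection $q:S^1\times S^2\to E$ such that $q(a,u)=q(b,v)$ if and only if $u=v$ and either $a=b$ or $u$ lies on the equator of $S^2$, and such that $q(a,u)\in C$ if and only if $u$ lies on the equator; and $E=E_+\cup E_-$ with $E_\pm$ as in 3, each homeomorphic to $S^3$, and $E_+\cap E_-=C$. -/

import Mathlib

namespace BlackRing

noncomputable section

/-- The metric function `H(x,y)` of the doubly-spinning black ring with parameters `lam`, `nu`.
The component `g_tt` of the metric is `-H(y,x)/H(x,y)`. -/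
def H (lam nu x y : ℝ) : ℝ :=
  1 + lam ^ 2 - nu ^ 2 + 2 * lam * nu * (1 - x ^ 2) * y + 2 * x * lam * (1 - y ^ 2 * nu ^ 2)
    + x ^ 2 * y ^ 2 * nu * (1 - lam ^ 2 - nu ^ 2)

/-- The metric function `G`. -/
def G (lam nu x : ℝ) : ℝ := (1 - x ^ 2) * (1 + lam * x + nu * x ^ 2)

/-- The position `y_h` of the horizon: the root of `1 + lam * y + nu * y ^ 2` closest to `0`,
in a form which is also valid for `nu = 0`, where it equals `-1/lam`
(see `horizonY_eq` for the usual expression). -/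
def horizonY (lam nu : ℝ) : ℝ := -2 / (lam + √(lam ^ 2 - 4 * nu))

theorem horizonY_eq {lam nu : ℝ} (hnu : 0 < nu) (h1 : 2 * √nu ≤ lam) :
    horizonY lam nu = (-lam + √(lam ^ 2 - 4 * nu)) / (2 * nu) := by
  have hs : 0 < √nu := Real.sqrt_pos.mpr hnu
  have hd : 0 ≤ lam ^ 2 - 4 * nu := by nlinarith [Real.sq_sqrt hnu.le]
  have hq := Real.sq_sqrt hd
  have h0 := Real.sqrt_nonneg (lam ^ 2 - 4 * nu)
  have hp : lam + √(lam ^ 2 - 4 * nu) ≠ 0 := by linarith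
  unfold horizonY
  rw [div_eq_div_iff hp (by positivity)]
  linarith

theorem horizonY_eq_of_nu_eq_zero {lam : ℝ} (h0 : 0 < lam) : horizonY lam 0 = -1 / lam := by
  unfold horizonY
  have : √(lam ^ 2 - 4 * 0) = lam := by simp [Real.sqrt_sq h0.le]
  rw [this]
  field_simp
  norm_num

theorem G_horizonY {lam nu : ℝ} (hnu : 0 ≤ nu) (h0 : 0 < lam) (h1 : 2 * √nu ≤ lam) :
    G lam nu (horizonY lam nu) = 0 := by
  have hs := Real.sqrt_nonneg nu
  have hd : 0 ≤ lam ^ 2 - 4 * nu := by nlinarith [Real.sq_sqrt hnu]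
  have hq := Real.sq_sqrt hd
  have h2 := Real.sqrt_nonneg (lam ^ 2 - 4 * nu)
  have hp : lam + √(lam ^ 2 - 4 * nu) ≠ 0 := by linarith
  have : 1 + lam * horizonY lam nu + nu * horizonY lam nu ^ 2 = 0 := by
    unfold horizonY
    field_simp
    nlinarith
  simp [G, this]

/-- The horizon lies in the coordinate range `y < -1`. -/
theorem horizonY_lt_neg_one {lam nu : ℝ} (hnu1 : nu < 1) (h0 : 0 < lam)
    (h2 : lam < 1 + nu) : horizonY lam nu < -1 := by
  have hs := Real.sqrt_nonneg (lam ^ 2 - 4 * nu)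
  have h3 : √(lam ^ 2 - 4 * nu) < 2 - lam := by
    rw [Real.sqrt_lt' (by linarith)]
    nlinarith
  unfold horizonY
  rw [div_lt_iff₀ (by linarith)]
  linarith

/-- The first polar radius `r₁` (conjugate to the angle `φ`) in terms of `(x,y)`. -/
def r₁ (R x y : ℝ) : ℝ := R * √(1 - x ^ 2) / (x - y)

/-- The second polar radius `r₂` (conjugate to the angle `ψ`) in terms of `(x,y)`. -/
def r₂ (R x y : ℝ) : ℝ := R * √(y ^ 2 - 1) / (x - y)

/-- The range `-1 ≤ x ≤ 1`, `y ≤ -1` of the pair `(x,y)`; the point `(-1,-1)`, which represents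
asymptotic infinity, is left out. -/
def coordRange : Set (ℝ × ℝ) := {p | -1 ≤ p.1 ∧ p.1 ≤ 1 ∧ p.2 ≤ -1 ∧ p ≠ (-1, -1)}

/-- The part of a spatial section `t = const` on which `(x,y)` lies in `S ⊆ coordRange`, with all
values of the angles `φ`, `ψ`.  The section is described in the two pairs of plane polar
coordinates `(r₁, φ)`, `(r₂, ψ)`, that is by `z = (r₁ * exp (i φ), r₂ * exp (i ψ))` in `ℂ × ℂ`;
so the `φ`-circle shrinks to a point on `x = ±1`, and the `ψ`-circle on `y = -1`. -/
def spatial (R : ℝ) (S : Set (ℝ × ℝ)) : Set (ℂ × ℂ) :=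
  {z | ∃ p ∈ S, ‖z.1‖ = r₁ R p.1 p.2 ∧ ‖z.2‖ = r₂ R p.1 p.2}

/-- The horizon `y = y_h`. -/
def horizon (R lam nu : ℝ) : Set (ℂ × ℂ) :=
  spatial R {p ∈ coordRange | p.2 = horizonY lam nu}

/-- The points `(x,y)` on or outside the horizon at which `H(y,x) = 0`. -/
def ergoCurve (lam nu : ℝ) : Set (ℝ × ℝ) :=
  {p ∈ coordRange | horizonY lam nu ≤ p.2 ∧ H lam nu p.2 p.1 = 0}

/-- The ergosurface `H(y,x) = 0`. -/
def ergosurface (R lam nu : ℝ) : Set (ℂ × ℂ) := spatial R (ergoCurve lam nu)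

/-- The part `x ≥ 0` of the ergosurface, on the side of the centre of the ring. -/
def innerErgosurface (R lam nu : ℝ) : Set (ℂ × ℂ) := spatial R {p ∈ ergoCurve lam nu | 0 ≤ p.1}

/-- The part `x ≤ 0` of the ergosurface, on the side of asymptotic infinity. -/
def outerErgosurface (R lam nu : ℝ) : Set (ℂ × ℂ) := spatial R {p ∈ ergoCurve lam nu | p.1 ≤ 0}

/-- `S` encloses the point `z`: `z` cannot be joined to infinity off `S`. -/
def Encloses (S : Set (ℂ × ℂ)) (z : ℂ × ℂ) : Prop :=
  z ∉ S ∧ Bornology.IsBounded (connectedComponentIn Sᶜ z)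

/-- The two-sphere. -/
abbrev S2 : Type := Metric.sphere (0 : EuclideanSpace ℝ (Fin 3)) 1

/-- The three-sphere. -/
abbrev S3 : Type := Metric.sphere (0 : EuclideanSpace ℝ (Fin 4)) 1

end

end BlackRing

/-! ### The root `y_e(x)` of `H(y,x)` between the horizon and `y = 0`. -/

namespace BlackRing

noncomputable section

/-! For fixed `x`, `H(y,x)` is a polynomial of degree at most two in `y`, negative at `y = y_h`
(`H_horizonY_neg`) and positive at `y = 0` (`H_zero_left_pos`). It therefore has exactly one root
`y_e(x)` in between, and the sign pattern makes `y_e` continuous (`exists_continuous_root`). The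
ergosurface is the part `y_e ≤ -1` of this graph.

On the axis, `H(-1,x)` factors as `(1+ν-λ)(1-λ-ν+x²ν(1+λ-ν))`, which is positive at `x = ±1`. So the
graph stays strictly below `y = -1` if `λ < 1-ν`, touches it only at `x = 0` if `λ = 1-ν`, and
exceeds it exactly for `|x| < x0`, with some `0 < x0 < 1`, if `λ > 1-ν`.

Topologically, `x` and `φ` together sweep out a two-sphere, and the `ψ`-circle over it collapses
exactly where the graph meets `y = -1`. This gives `S¹ × S²`, or its pinched quotient
(`graphParam_eq_iff`). A half of the graph running from `y = -1` to `x = ±1` is an arc from one axis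
to the other in the quadrant of polar radii, and rotation turns it into a three-sphere
(`nonempty_homeomorph_S3_of_graph`).

For enclosure, the regions below the graph (with the ring added) and above it are disjoint open
sets, and the lower one is bounded because infinity is `x = y = -1` while `y_e(-1) < -1`. The two
halves are treated by cutting along the sphere `r₁² + r₂² = R²`, that is `x = 0`, which for `λ >
1-ν` lies entirely below the graph. -/

theorem H_neg_one (lam nu x : ℝ) :
    H lam nu (-1) x = (1 + nu - lam) * (1 - lam - nu + x ^ 2 * (nu * (1 + lam - nu))) := by
  unfold H; ring

theorem H_neg_one_left_pos {lam nu x : ℝ} (hnu1 : nu < 1) (h2 : lam < 1 + nu) (hx : x ^ 2 = 1) :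
    0 < H lam nu (-1) x := by
  rw [H_neg_one, hx]
  have : 1 - lam - nu + 1 * (nu * (1 + lam - nu)) = (1 - nu) * (1 + nu - lam) := by ring
  rw [this]
  have h3 : 0 < 1 + nu - lam := by linarith
  have h4 : 0 < 1 - nu := by linarith
  positivity

/-- The upper end of the search interval for the root is `y = 0` and not `-1`, since the root may
exceed `-1`. Positivity comes from `λ ≥ 2√ν ≥ 2ν`, which gives `λ² + 2λνx ≥ λ(λ-2ν) ≥ 0`. -/
theorem H_zero_left_pos {lam nu x : ℝ} (hnu0 : 0 ≤ nu) (hnu1 : nu < 1) (h0 : 0 < lam)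
    (h1 : 2 * √nu ≤ lam) (hx : x ∈ Set.Icc (-1 : ℝ) 1) : 0 < H lam nu 0 x := by
  have hs := Real.sqrt_nonneg nu
  have hq := Real.sq_sqrt hnu0
  have hs1 : √nu < 1 := by rw [Real.sqrt_lt' one_pos]; simpa using hnu1
  have hnl : 2 * nu ≤ lam := by nlinarith
  have h : 0 ≤ lam * nu * (1 + x) := mul_nonneg (mul_nonneg h0.le hnu0) (by linarith [hx.1])
  have h' : 0 ≤ lam * (lam - 2 * nu) := mul_nonneg h0.le (by linarith)
  unfold H
  nlinarith

/-- With `λ = a+b`, `ν = ab` one has `1+λy+νy² = (1+ay)(1+by)`, so the root `-1/a` is free of square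
roots. Expanding about `x = -1` isolates the negative term `-(a+b)(1-b)²`. -/
theorem H_at_root {a : ℝ} (ha : a ≠ 0) (b x : ℝ) :
    H (a + b) (a * b) (-1 / a) x = (1 - a ^ 2) / a *
      (-((a + b) * (1 - b) ^ 2) + (x + 1) * (b * (1 - 2 * a * b - b ^ 2) * (x - 1)
        - 2 * b * (a + b))) := by
  unfold H
  field_simp
  ring

theorem H_horizonY_neg {lam nu x : ℝ} (hnu0 : 0 ≤ nu) (hnu1 : nu < 1) (h0 : 0 < lam)
    (h1 : 2 * √nu ≤ lam) (h2 : lam < 1 + nu) (hx : x ∈ Set.Icc (-1 : ℝ) 1) :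
    H lam nu (horizonY lam nu) x < 0 := by
  have hs := Real.sqrt_nonneg nu
  have hd : 0 ≤ lam ^ 2 - 4 * nu := by nlinarith [Real.sq_sqrt hnu0]
  have hq := Real.sq_sqrt hd
  have hs' := Real.sqrt_nonneg (lam ^ 2 - 4 * nu)
  have h3 : √(lam ^ 2 - 4 * nu) < 2 - lam := by
    rw [Real.sqrt_lt' (by linarith)]
    nlinarith
  have h4 : √(lam ^ 2 - 4 * nu) ≤ lam := by
    rw [Real.sqrt_le_left h0.le]
    linarith
  set s := √(lam ^ 2 - 4 * nu) with hsdef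
  obtain ⟨a, ha⟩ : ∃ a, a = (lam + s) / 2 := ⟨_, rfl⟩
  obtain ⟨b, hb⟩ : ∃ b, b = (lam - s) / 2 := ⟨_, rfl⟩
  have ha0 : 0 < a := by linarith
  have ha1 : a < 1 := by linarith
  have hb0 : 0 ≤ b := by linarith
  have hb1 : b < 1 := by linarith
  have hy : horizonY lam nu = -1 / a := by
    unfold horizonY
    rw [← hsdef, ha, div_eq_div_iff (by linarith) (by linarith)]
    ring
  have e1 : lam = a + b := by linarith
  have e2 : nu = a * b := by rw [ha, hb]; nlinarith
  rw [hy, e1, e2, H_at_root ha0.ne']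
  apply mul_neg_of_pos_of_neg
  · apply div_pos _ ha0
    nlinarith
  · have k1 : 0 < (a + b) * (1 - b) ^ 2 := by
      have : 0 < 1 - b := by linarith
      positivity
    have k2 : 0 ≤ (1 - b ^ 2) + a * (1 - b) + b * (1 - a) := by
      have := mul_nonneg ha0.le (sub_nonneg.2 hb1.le)
      have := mul_nonneg hb0 (sub_nonneg.2 ha1.le)
      nlinarith
    -- The expression is affine in `x`; it is rewritten with weights `1-x` and `1+x` from its values
    -- at `x = -1` and `x = 1`, both nonpositive.
    have k3 : b * (1 - 2 * a * b - b ^ 2) * (x - 1) - 2 * b * (a + b)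
        = -(b * ((1 - x) * ((1 - b ^ 2) + a * (1 - b) + b * (1 - a)) + (1 + x) * (a + b))) := by
      ring
    have k4 : 0 ≤ b * ((1 - x) * ((1 - b ^ 2) + a * (1 - b) + b * (1 - a)) + (1 + x) * (a + b)) := by
      apply mul_nonneg hb0
      apply add_nonneg
      · exact mul_nonneg (by linarith [hx.2]) k2
      · exact mul_nonneg (by linarith [hx.1]) (by linarith)
    rw [k3]
    nlinarith [mul_nonneg (by linarith [hx.1] : 0 ≤ x + 1) k4]

/-- After the root `r` is split off, the cofactor `A(y+r)+B` is affine in `y` and positive at both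
ends, hence on the whole interval. No assumption on the sign of `A` is needed, and `A = 0` is
allowed. -/
theorem exists_root_of_quadratic {A B C h k : ℝ} (hhk : h < k) (hh : A * h ^ 2 + B * h + C < 0)
    (hk : 0 < A * k ^ 2 + B * k + C) :
    ∃ r, h < r ∧ r < k ∧ ∀ y ∈ Set.Icc h k, (A * y ^ 2 + B * y + C < 0 ↔ y < r) ∧
      (A * y ^ 2 + B * y + C = 0 ↔ y = r) := by
  have hc : ContinuousOn (fun y : ℝ => A * y ^ 2 + B * y + C) (Set.Icc h k) := by fun_prop
  obtain ⟨r, ⟨hr1, hr2⟩, hr⟩ := intermediate_value_Ioo hhk.le hc ⟨hh, hk⟩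
  simp only at hr
  refine ⟨r, hr1, hr2, fun y hy => ?_⟩
  have fac : ∀ y, A * y ^ 2 + B * y + C = (y - r) * (A * (y + r) + B) := fun y => by
    linear_combination hr
  rw [fac] at hh hk ⊢
  have l1 : 0 < A * (h + r) + B := by
    by_contra hcon
    nlinarith
  have l2 : 0 < A * (k + r) + B := by
    by_contra hcon
    nlinarith
  have l3 : 0 < A * (y + r) + B := by
    have e : (k - h) * (A * (y + r) + B)
        = (y - h) * (A * (k + r) + B) + (k - y) * (A * (h + r) + B) := by ring
    refine pos_of_mul_pos_right (b := A * (y + r) + B) (a := k - h) ?_ (by linarith)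
    rw [e]
    rcases hy.1.eq_or_lt with h' | h'
    · rw [← h']
      nlinarith
    · exact add_pos_of_pos_of_nonneg (mul_pos (by linarith) l2)
        (mul_nonneg (by linarith [hy.2]) l1.le)
  constructor
  · rw [mul_neg_iff]
    constructor
    · rintro (h' | h') <;> linarith
    · exact fun h' => Or.inr ⟨by linarith, l3⟩
  · rw [mul_eq_zero, or_iff_left l3.ne', sub_eq_zero]

/-- The ergosurface is the graph of a continuous function of `x`. -/
theorem exists_continuous_root {lam nu : ℝ} (hnu0 : 0 ≤ nu) (hnu1 : nu < 1) (h0 : 0 < lam)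
    (h1 : 2 * √nu ≤ lam) (h2 : lam < 1 + nu) :
    ∃ ye : ℝ → ℝ, Continuous ye ∧ ∀ x ∈ Set.Icc (-1 : ℝ) 1,
      horizonY lam nu < ye x ∧ ye x < 0 ∧ ∀ y ∈ Set.Icc (horizonY lam nu) 0,
        (H lam nu y x < 0 ↔ y < ye x) ∧ (H lam nu y x = 0 ↔ y = ye x) := by
  have hyh := horizonY_lt_neg_one hnu1 h0 h2
  have key : ∀ x : Set.Icc (-1 : ℝ) 1, ∃ r, horizonY lam nu < r ∧ r < 0 ∧
      ∀ y ∈ Set.Icc (horizonY lam nu) 0,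
        (H lam nu y x < 0 ↔ y < r) ∧ (H lam nu y x = 0 ↔ y = r) := fun x => by
    have e : ∀ y, H lam nu y x = (-2 * lam * nu * x + x ^ 2 * nu * (1 - lam ^ 2 - nu ^ 2)) * y ^ 2
        + 2 * lam * (1 - x ^ 2 * nu ^ 2) * y + (1 + lam ^ 2 - nu ^ 2 + 2 * lam * nu * x) :=
      fun y => by unfold H; ring
    have n := H_horizonY_neg hnu0 hnu1 h0 h1 h2 x.2
    have p := H_zero_left_pos hnu0 hnu1 h0 h1 x.2
    simp only [e] at n p ⊢
    exact exists_root_of_quadratic (by linarith) n p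
  choose f hf1 hf2 hf3 using key
  have hcH : ∀ y : ℝ, Continuous fun x : Set.Icc (-1 : ℝ) 1 => H lam nu y x := fun y => by
    unfold H; fun_prop
  have hf : Continuous f := by
    rw [continuous_iff_continuousAt]
    intro x
    -- For `c` in the interval, `c < f x` and `f x < c` amount to `H(c,x) < 0` and `H(c,x) > 0`,
    -- open conditions on `x`.
    refine tendsto_order.2 ⟨fun c hc => ?_, fun c hc => ?_⟩
    · by_cases hc' : c ≤ horizonY lam nu
      · exact Filter.Eventually.of_forall fun z => hc'.trans_lt (hf1 z)
      · have hcm : c ∈ Set.Icc (horizonY lam nu) 0 :=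
          ⟨by linarith, by linarith [hf2 x]⟩
        filter_upwards [(hcH c).continuousAt.eventually_lt_const ((hf3 x c hcm).1.2 hc)] with z hz
        exact (hf3 z c hcm).1.1 hz
    · by_cases hc' : 0 ≤ c
      · exact Filter.Eventually.of_forall fun z => (hf2 z).trans_le hc'
      · have hcm : c ∈ Set.Icc (horizonY lam nu) 0 :=
          ⟨by linarith [hf1 x], by linarith⟩
        have hpos : 0 < H lam nu c x := by
          by_contra hcon
          rcases (not_lt.1 hcon).lt_or_eq with h | h
          · exact absurd ((hf3 x c hcm).1.1 h) (by linarith)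
          · exact absurd ((hf3 x c hcm).2.1 h) (by linarith)
        filter_upwards [(hcH c).continuousAt.eventually_const_lt hpos] with z hz
        by_contra hcon
        rcases (not_lt.1 hcon).lt_or_eq with h | h
        · exact absurd ((hf3 z c hcm).1.2 h) (by linarith)
        · exact absurd ((hf3 z c hcm).2.2 h) (by linarith)
  refine ⟨Set.IccExtend (by norm_num) f, hf.Icc_extend', fun x hx => ?_⟩
  rw [Set.IccExtend_of_mem _ _ hx]
  exact ⟨hf1 _, hf2 _, hf3 ⟨x, hx⟩⟩

end

end BlackRing

/-! ### Ring coordinates as functions on the spatial section. -/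

namespace BlackRing

noncomputable section

/-- The square of the Euclidean norm on `ℂ × ℂ`. -/
def euclNormSq (z : ℂ × ℂ) : ℝ := ‖z.1‖ ^ 2 + ‖z.2‖ ^ 2

/-- The common denominator of the ring coordinates; it vanishes exactly on the ring
`r₁ = 0`, `r₂ = R`. -/
def ringDenom (R : ℝ) (z : ℂ × ℂ) : ℝ :=
  √((euclNormSq z - R ^ 2) ^ 2 + 4 * R ^ 2 * ‖z.1‖ ^ 2)

/-- The ring coordinate `x` as a function on the spatial section. -/
def ringX (R : ℝ) (z : ℂ × ℂ) : ℝ := (R ^ 2 - euclNormSq z) / ringDenom R z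

/-- The ring coordinate `y` as a function on the spatial section. -/
def ringY (R : ℝ) (z : ℂ × ℂ) : ℝ := -(euclNormSq z + R ^ 2) / ringDenom R z

variable {R : ℝ} {z : ℂ × ℂ}

theorem euclNormSq_nonneg (z : ℂ × ℂ) : 0 ≤ euclNormSq z := by unfold euclNormSq; positivity

theorem ringDenom_nonneg (R : ℝ) (z : ℂ × ℂ) : 0 ≤ ringDenom R z := Real.sqrt_nonneg _

theorem ringDenom_sq (R : ℝ) (z : ℂ × ℂ) :
    ringDenom R z ^ 2 = (euclNormSq z - R ^ 2) ^ 2 + 4 * R ^ 2 * ‖z.1‖ ^ 2 :=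
  Real.sq_sqrt (by positivity)

/-- Of the two expressions for the squared denominator, `ringDenom_sq` makes `1-x²` a perfect square
and this one makes `y²-1` a perfect square. -/
theorem ringDenom_sq' (R : ℝ) (z : ℂ × ℂ) :
    ringDenom R z ^ 2 = (euclNormSq z + R ^ 2) ^ 2 - 4 * R ^ 2 * ‖z.2‖ ^ 2 := by
  rw [ringDenom_sq]; unfold euclNormSq; ring

@[fun_prop]
theorem continuous_euclNormSq : Continuous euclNormSq := by unfold euclNormSq; fun_prop

@[fun_prop]
theorem continuous_ringDenom (R : ℝ) : Continuous (ringDenom R) := by unfold ringDenom; fun_prop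

theorem isOpen_ringDenom_ne_zero (R : ℝ) : IsOpen {z | ringDenom R z ≠ 0} :=
  isOpen_ne_fun (continuous_ringDenom R) continuous_const

theorem continuousOn_ringX (R : ℝ) : ContinuousOn (ringX R) {z | ringDenom R z ≠ 0} := by
  unfold ringX
  exact ContinuousOn.div (by fun_prop) (by fun_prop) fun _ h => h

theorem continuousOn_ringY (R : ℝ) : ContinuousOn (ringY R) {z | ringDenom R z ≠ 0} := by
  unfold ringY
  exact ContinuousOn.div (by fun_prop) (by fun_prop) fun _ h => h

theorem ringX_sub_ringY (R : ℝ) (z : ℂ × ℂ) :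
    ringX R z - ringY R z = 2 * R ^ 2 / ringDenom R z := by
  unfold ringX ringY; ring

theorem one_sub_ringX_sq (hD : ringDenom R z ≠ 0) :
    1 - ringX R z ^ 2 = (2 * R * ‖z.1‖ / ringDenom R z) ^ 2 := by
  unfold ringX
  field_simp
  linear_combination ringDenom_sq R z

theorem ringY_sq_sub_one (hD : ringDenom R z ≠ 0) :
    ringY R z ^ 2 - 1 = (2 * R * ‖z.2‖ / ringDenom R z) ^ 2 := by
  unfold ringY
  field_simp
  linear_combination -ringDenom_sq' R z

theorem ringDenom_pos (hD : ringDenom R z ≠ 0) : 0 < ringDenom R z :=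
  (ringDenom_nonneg R z).lt_of_ne' hD

theorem ringX_mem_Icc (hD : ringDenom R z ≠ 0) : ringX R z ∈ Set.Icc (-1 : ℝ) 1 := by
  have h := one_sub_ringX_sq hD
  have h' := sq_nonneg (2 * R * ‖z.1‖ / ringDenom R z)
  exact abs_le.1 (abs_le_one_iff_mul_self_le_one.2 (by nlinarith))

theorem ringY_le (hD : ringDenom R z ≠ 0) : ringY R z ≤ -1 := by
  have h := ringY_sq_sub_one hD
  have h' := sq_nonneg (2 * R * ‖z.2‖ / ringDenom R z)
  have h2 : ringY R z ≤ 0 := by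
    unfold ringY
    exact div_nonpos_of_nonpos_of_nonneg (by nlinarith [euclNormSq_nonneg z])
      (ringDenom_nonneg R z)
  nlinarith

theorem ringXY_mem_coordRange (hR : 0 < R) (hD : ringDenom R z ≠ 0) :
    (ringX R z, ringY R z) ∈ coordRange := by
  refine ⟨(ringX_mem_Icc hD).1, (ringX_mem_Icc hD).2, ringY_le hD, fun h => ?_⟩
  rw [Prod.mk.injEq] at h
  have h1 := ringX_sub_ringY R z
  have h2 := ringDenom_pos hD
  have : 0 < 2 * R ^ 2 / ringDenom R z := by positivity
  linarith

theorem sub_pos_of_mem_coordRange {p : ℝ × ℝ} (hp : p ∈ coordRange) : 0 < p.1 - p.2 := by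
  obtain ⟨h1, h2, h3, h4⟩ := hp
  by_contra hcon
  exact h4 (Prod.ext (by simp; linarith) (by simp; linarith))

theorem sq_r₁ {p : ℝ × ℝ} (hp : p ∈ coordRange) :
    r₁ R p.1 p.2 ^ 2 = R ^ 2 * (1 - p.1 ^ 2) / (p.1 - p.2) ^ 2 := by
  have : 0 ≤ 1 - p.1 ^ 2 := by nlinarith [hp.1, hp.2.1]
  rw [r₁, div_pow, mul_pow, Real.sq_sqrt this]

theorem sq_r₂ {p : ℝ × ℝ} (hp : p ∈ coordRange) :
    r₂ R p.1 p.2 ^ 2 = R ^ 2 * (p.2 ^ 2 - 1) / (p.1 - p.2) ^ 2 := by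
  have : 0 ≤ p.2 ^ 2 - 1 := by nlinarith [hp.2.2.1]
  rw [r₂, div_pow, mul_pow, Real.sq_sqrt this]

/-- `ringX`, `ringY` invert the polar radii. -/
theorem norm_eq_polar_iff (hR : 0 < R) {p : ℝ × ℝ} (hp : p ∈ coordRange) :
    (‖z.1‖ = r₁ R p.1 p.2 ∧ ‖z.2‖ = r₂ R p.1 p.2) ↔
      ringDenom R z ≠ 0 ∧ (ringX R z, ringY R z) = p := by
  have hpos := sub_pos_of_mem_coordRange hp
  constructor
  · rintro ⟨h1, h2⟩
    -- In `r₁² + r₂²` the numerator is `R²(y²-x²)`, which cancels one factor `x-y`.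
    have hS : euclNormSq z = R ^ 2 * (-p.1 - p.2) / (p.1 - p.2) := by
      unfold euclNormSq
      rw [h1, h2, sq_r₁ hp, sq_r₂ hp]
      field_simp
      ring
    have hD : ringDenom R z = 2 * R ^ 2 / (p.1 - p.2) := by
      rw [← sq_eq_sq₀ (ringDenom_nonneg R z) (by positivity), ringDenom_sq, hS, h1, sq_r₁ hp]
      field_simp
      ring
    refine ⟨by rw [hD]; positivity, Prod.ext ?_ ?_⟩
    · simp only [ringX, hS, hD]
      field_simp
      ring
    · simp only [ringY, hS, hD]
      field_simp
      ring
  · rintro ⟨hD, rfl⟩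
    have hD' := ringDenom_pos hD
    constructor
    · simp only [r₁]
      rw [one_sub_ringX_sq hD, ringX_sub_ringY, Real.sqrt_sq (by positivity)]
      field_simp
    · simp only [r₂]
      rw [ringY_sq_sub_one hD, ringX_sub_ringY, Real.sqrt_sq (by positivity)]
      field_simp

theorem mem_spatial_iff (hR : 0 < R) {S : Set (ℝ × ℝ)} (hS : S ⊆ coordRange) :
    z ∈ spatial R S ↔ ringDenom R z ≠ 0 ∧ (ringX R z, ringY R z) ∈ S := by
  constructor
  · rintro ⟨p, hp, h⟩
    obtain ⟨h1, h2⟩ := (norm_eq_polar_iff hR (hS hp)).1 h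
    exact ⟨h1, h2 ▸ hp⟩
  · rintro ⟨h1, h2⟩
    exact ⟨_, h2, (norm_eq_polar_iff hR (hS h2)).2 ⟨h1, rfl⟩⟩

/-- The radii are realised by a point with both angles zero, from which `ringX` and `ringY` recover
the pair. -/
theorem polar_injOn (hR : 0 < R) {p q : ℝ × ℝ} (hp : p ∈ coordRange) (hq : q ∈ coordRange)
    (h1 : r₁ R p.1 p.2 = r₁ R q.1 q.2) (h2 : r₂ R p.1 p.2 = r₂ R q.1 q.2) : p = q := by
  have n1 : 0 ≤ r₁ R p.1 p.2 := by
    have := sub_pos_of_mem_coordRange hp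
    unfold r₁; positivity
  have n2 : 0 ≤ r₂ R p.1 p.2 := by
    have := sub_pos_of_mem_coordRange hp
    unfold r₂; positivity
  let z : ℂ × ℂ := (((r₁ R p.1 p.2 : ℝ) : ℂ), ((r₂ R p.1 p.2 : ℝ) : ℂ))
  have e1 : ‖z.1‖ = r₁ R p.1 p.2 := by simp [z, abs_of_nonneg n1]
  have e2 : ‖z.2‖ = r₂ R p.1 p.2 := by simp [z, abs_of_nonneg n2]
  rw [← ((norm_eq_polar_iff hR hp).1 ⟨e1, e2⟩).2,
    ((norm_eq_polar_iff hR hq).1 ⟨e1.trans h1, e2.trans h2⟩).2]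

theorem r₁_nonneg (hR : 0 < R) {p : ℝ × ℝ} (hp : p ∈ coordRange) : 0 ≤ r₁ R p.1 p.2 := by
  have := sub_pos_of_mem_coordRange hp
  unfold r₁; positivity

theorem r₂_nonneg (hR : 0 < R) {p : ℝ × ℝ} (hp : p ∈ coordRange) : 0 ≤ r₂ R p.1 p.2 := by
  have := sub_pos_of_mem_coordRange hp
  unfold r₂; positivity

theorem r₁_eq_zero_iff (hR : 0 < R) {p : ℝ × ℝ} (hp : p ∈ coordRange) :
    r₁ R p.1 p.2 = 0 ↔ p.1 ^ 2 = 1 := by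
  have h0 := sub_pos_of_mem_coordRange hp
  have : 0 ≤ 1 - p.1 ^ 2 := by nlinarith [hp.1, hp.2.1]
  rw [r₁, div_eq_zero_iff, or_iff_left h0.ne', mul_eq_zero, or_iff_right hR.ne',
    Real.sqrt_eq_zero this, sub_eq_zero, eq_comm]

theorem r₂_eq_zero_iff (hR : 0 < R) {p : ℝ × ℝ} (hp : p ∈ coordRange) :
    r₂ R p.1 p.2 = 0 ↔ p.2 = -1 := by
  have h0 := sub_pos_of_mem_coordRange hp
  have : 0 ≤ p.2 ^ 2 - 1 := by nlinarith [hp.2.2.1]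
  rw [r₂, div_eq_zero_iff, or_iff_left h0.ne', mul_eq_zero, or_iff_right hR.ne',
    Real.sqrt_eq_zero this, sub_eq_zero]
  constructor
  · intro h; nlinarith [hp.2.2.1]
  · intro h; rw [h]; norm_num

end

end BlackRing

/-! ### Topology of rotated graphs: `S¹ × S²` and `S³`. -/

namespace BlackRing

noncomputable section

/-- A continuous injection of a compact space is a homeomorphism onto its image. -/
theorem nonempty_homeomorph_of_range_eq {X Y : Type*} [TopologicalSpace X] [TopologicalSpace Y]
    [CompactSpace X] [T2Space Y] {f : X → Y} {S : Set Y} (hf : Continuous f)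
    (hinj : Function.Injective f) (hS : Set.range f = S) : Nonempty (S ≃ₜ X) := by
  subst hS
  exact ⟨(hf.isClosedEmbedding hinj).isEmbedding.toHomeomorph.symm⟩

/-- A unit vector in the direction of `w`. -/
def dir (w : ℂ) : ℂ := if w = 0 then 1 else w / ‖w‖

@[simp]
theorem norm_dir (w : ℂ) : ‖dir w‖ = 1 := by
  unfold dir
  split_ifs with h
  · simp
  · simp [h]

theorem norm_mul_dir (w : ℂ) : (‖w‖ : ℂ) * dir w = w := by
  unfold dir
  split_ifs with h
  · simp [h]
  · field_simp [show (‖w‖ : ℂ) ≠ 0 by simpa using h]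

theorem dir_mul {t : ℝ} (ht : 0 < t) {w : ℂ} (hw : ‖w‖ = 1) : dir (t * w) = w := by
  have hw0 : w ≠ 0 := by rintro rfl; simp at hw
  have ht' : (t : ℂ) ≠ 0 := by exact_mod_cast ht.ne'
  rw [dir, if_neg (mul_ne_zero ht' hw0)]
  simp [hw, abs_of_pos ht, ht']

/-- At a zero of `w` the direction may jump, but it has norm one and its coefficient tends to zero.
The default value of `dir` at `0` is thus harmless. -/
theorem continuous_mul_dir {X : Type*} [TopologicalSpace X] {c : X → ℝ} {w : X → ℂ}
    (hc : Continuous c) (hw : Continuous w) (h : ∀ x, w x = 0 → c x = 0) :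
    Continuous fun x => (c x : ℂ) * dir (w x) := by
  rw [continuous_iff_continuousAt]
  intro x
  by_cases hx : w x = 0
  · rw [ContinuousAt, h x hx, Complex.ofReal_zero, zero_mul]
    refine squeeze_zero_norm (a := fun x => ‖c x‖) (fun y => by simp) ?_
    have := hc.norm.tendsto x
    rwa [h x hx, norm_zero] at this
  · have h1 : ContinuousAt (fun x => (c x : ℂ) * (w x / ‖w x‖)) x := by
      refine ContinuousAt.mul (by fun_prop) (ContinuousAt.div (by fun_prop) (by fun_prop) ?_)
      simpa using hx
    refine h1.congr ?_
    filter_upwards [hw.continuousAt.eventually_ne hx] with y hy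
    rw [dir, if_neg hy]

/-- The first complex coordinate on the three-sphere. -/
def sphereFst (u : S3) : ℂ := ⟨u.1 0, u.1 1⟩

/-- The second complex coordinate on the three-sphere. -/
def sphereSnd (u : S3) : ℂ := ⟨u.1 2, u.1 3⟩

theorem continuous_complex_mk {X : Type*} [TopologicalSpace X] {f g : X → ℝ}
    (hf : Continuous f) (hg : Continuous g) : Continuous fun x => (⟨f x, g x⟩ : ℂ) :=
  Complex.equivRealProdCLM.symm.continuous.comp (hf.prodMk hg)

theorem continuous_sphereFst : Continuous sphereFst :=
  continuous_complex_mk (by fun_prop) (by fun_prop)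

theorem continuous_sphereSnd : Continuous sphereSnd :=
  continuous_complex_mk (by fun_prop) (by fun_prop)

theorem norm_complex_sq (w : ℂ) : ‖w‖ ^ 2 = w.re ^ 2 + w.im ^ 2 := by
  rw [Complex.sq_norm, Complex.normSq_apply]; ring

theorem sphere_norm_sq (u : S3) : ‖sphereFst u‖ ^ 2 + ‖sphereSnd u‖ ^ 2 = 1 := by
  have h : ‖u.1‖ = 1 := mem_sphere_zero_iff_norm.1 u.2
  have h2 := EuclideanSpace.norm_sq_eq u.1
  rw [h, Fin.sum_univ_four] at h2
  simp only [Real.norm_eq_abs, sq_abs] at h2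
  rw [norm_complex_sq, norm_complex_sq, sphereFst, sphereSnd]
  linarith

theorem exists_sphere_of_norm_sq {a b : ℂ} (h : ‖a‖ ^ 2 + ‖b‖ ^ 2 = 1) :
    ∃ u : S3, sphereFst u = a ∧ sphereSnd u = b := by
  refine ⟨⟨!₂[a.re, a.im, b.re, b.im], ?_⟩, ?_, ?_⟩
  · rw [mem_sphere_zero_iff_norm, ← sq_eq_sq₀ (norm_nonneg _) zero_le_one,
      EuclideanSpace.norm_sq_eq, Fin.sum_univ_four]
    rw [norm_complex_sq, norm_complex_sq] at h
    simp
    linarith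
  · simp [sphereFst]
  · simp [sphereSnd]

theorem sphere_ext {u v : S3} (h1 : sphereFst u = sphereFst v) (h2 : sphereSnd u = sphereSnd v) :
    u = v := by
  simp only [sphereFst, sphereSnd, Complex.mk.injEq] at h1 h2
  ext i
  fin_cases i
  exacts [h1.1, h1.2, h2.1, h2.2]

/-- Rotating an arc in the quadrant of pairs of polar radii, which runs from one axis to the
other and meets the axes only in its ends, sweeps out a three-sphere. -/
theorem nonempty_homeomorph_S3_of_arc {f g : ℝ → ℝ} (hf : ContinuousOn f (Set.Icc 0 1))
    (hg : ContinuousOn g (Set.Icc 0 1)) (hf0 : ∀ s ∈ Set.Icc (0 : ℝ) 1, 0 ≤ f s)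
    (hg0 : ∀ s ∈ Set.Icc (0 : ℝ) 1, 0 ≤ g s) (hf1 : ∀ s ∈ Set.Icc (0 : ℝ) 1, f s = 0 ↔ s = 1)
    (hg1 : ∀ s ∈ Set.Icc (0 : ℝ) 1, g s = 0 ↔ s = 0)
    (hinj : ∀ s ∈ Set.Icc (0 : ℝ) 1, ∀ t ∈ Set.Icc (0 : ℝ) 1, f s = f t → g s = g t → s = t) :
    Nonempty ({z : ℂ × ℂ | ∃ s ∈ Set.Icc (0 : ℝ) 1, ‖z.1‖ = f s ∧ ‖z.2‖ = g s} ≃ₜ S3) := by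
  have hmem : ∀ u : S3, ‖sphereSnd u‖ ∈ Set.Icc (0 : ℝ) 1 := fun u =>
    ⟨norm_nonneg _, by nlinarith [sphere_norm_sq u, norm_nonneg (sphereSnd u)]⟩
  have hfst : ∀ u : S3, sphereFst u = 0 ↔ ‖sphereSnd u‖ = 1 := fun u => by
    have h := sphere_norm_sq u
    rw [← norm_eq_zero]
    constructor
    · intro h0
      rw [h0] at h
      nlinarith [norm_nonneg (sphereSnd u)]
    · intro h0
      rw [h0] at h
      nlinarith [norm_nonneg (sphereFst u)]
  -- The arc parameter is the modulus of the second coordinate; the moduli of a point of the sphere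
  -- are replaced by `f` and `g` while its directions are kept.
  let F : S3 → ℂ × ℂ := fun u =>
    ((f ‖sphereSnd u‖ : ℂ) * dir (sphereFst u), (g ‖sphereSnd u‖ : ℂ) * dir (sphereSnd u))
  have nF1 : ∀ u, ‖(F u).1‖ = f ‖sphereSnd u‖ := fun u => by
    simp [F, abs_of_nonneg (hf0 _ (hmem u))]
  have nF2 : ∀ u, ‖(F u).2‖ = g ‖sphereSnd u‖ := fun u => by
    simp [F, abs_of_nonneg (hg0 _ (hmem u))]
  refine nonempty_homeomorph_of_range_eq (f := F) ?_ ?_ ?_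
  · refine Continuous.prodMk (continuous_mul_dir ?_ continuous_sphereFst fun u hu => ?_)
      (continuous_mul_dir ?_ continuous_sphereSnd fun u hu => ?_)
    · exact hf.comp_continuous continuous_sphereSnd.norm hmem
    · exact (hf1 _ (hmem u)).2 ((hfst u).1 hu)
    · exact hg.comp_continuous continuous_sphereSnd.norm hmem
    · exact (hg1 _ (hmem u)).2 (by rw [hu, norm_zero])
  · intro u v huv
    have hs : ‖sphereSnd u‖ = ‖sphereSnd v‖ :=
      hinj _ (hmem u) _ (hmem v) (by rw [← nF1, ← nF1, huv]) (by rw [← nF2, ← nF2, huv])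
    have hs' : ‖sphereFst u‖ = ‖sphereFst v‖ := by
      rw [← sq_eq_sq₀ (norm_nonneg _) (norm_nonneg _)]
      have := sphere_norm_sq u
      have := sphere_norm_sq v
      rw [hs] at *
      linarith
    have h1 : (F u).1 = (F v).1 := by rw [huv]
    have h2 : (F u).2 = (F v).2 := by rw [huv]
    simp only [F, hs] at h1 h2
    apply sphere_ext
    · by_cases h0 : ‖sphereSnd v‖ = 1
      · rw [(hfst v).2 h0, (hfst u).2 (hs.trans h0)]
      · have : (f ‖sphereSnd v‖ : ℂ) ≠ 0 := by
          exact_mod_cast fun h => h0 ((hf1 _ (hmem v)).1 h)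
        rw [← norm_mul_dir (sphereFst u), mul_left_cancel₀ this h1, hs', norm_mul_dir]
    · by_cases h0 : ‖sphereSnd v‖ = 0
      · rw [norm_eq_zero.1 h0, norm_eq_zero.1 (hs.trans h0)]
      · have : (g ‖sphereSnd v‖ : ℂ) ≠ 0 := by
          exact_mod_cast fun h => h0 ((hg1 _ (hmem v)).1 h)
        rw [← norm_mul_dir (sphereSnd u), mul_left_cancel₀ this h2, hs, norm_mul_dir]
  · ext z
    constructor
    · rintro ⟨u, rfl⟩
      exact ⟨_, hmem u, nF1 u, nF2 u⟩
    · rintro ⟨s, hs, h1, h2⟩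
      have hs2 : 0 ≤ 1 - s ^ 2 := by nlinarith [hs.1, hs.2]
      obtain ⟨u, hu1, hu2⟩ := exists_sphere_of_norm_sq
        (a := (√(1 - s ^ 2) : ℝ) * dir z.1) (b := (s : ℂ) * dir z.2) (by
          simp [Real.sq_sqrt hs2])
      have hns : ‖sphereSnd u‖ = s := by simp [hu2, abs_of_nonneg hs.1]
      refine ⟨u, Prod.ext ?_ ?_⟩
      · simp only [F, hns, hu1]
        by_cases h0 : s = 1
        · rw [(hf1 s hs).2 h0] at h1 ⊢
          rw [norm_eq_zero.1 h1]; simp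
        · have : s < 1 := lt_of_le_of_ne hs.2 h0
          rw [dir_mul (Real.sqrt_pos.2 (by nlinarith [hs.1])) (norm_dir _), ← h1, norm_mul_dir]
      · simp only [F, hns]
        rw [hu2]
        by_cases h0 : s = 0
        · rw [(hg1 s hs).2 h0] at h2 ⊢
          rw [norm_eq_zero.1 h2]; simp
        · rw [dir_mul (lt_of_le_of_ne hs.1 (Ne.symm h0)) (norm_dir _), ← h2, norm_mul_dir]

theorem S2_norm_sq (u : S2) : u.1 0 ^ 2 + u.1 1 ^ 2 + u.1 2 ^ 2 = 1 := by
  have h : ‖u.1‖ = 1 := mem_sphere_zero_iff_norm.1 u.2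
  have h2 := EuclideanSpace.norm_sq_eq u.1
  rw [h, Fin.sum_univ_three] at h2
  simp only [Real.norm_eq_abs, sq_abs] at h2
  linarith

/-- A graph `y = f x` over the whole interval `-1 ≤ x ≤ 1`, parametrised by `S¹ × S²`. -/
def graphParam (R : ℝ) (f : ℝ → ℝ) (w : Circle × S2) : ℂ × ℂ :=
  (((R / (w.2.1 2 - f (w.2.1 2)) : ℝ) : ℂ) * ⟨w.2.1 0, w.2.1 1⟩,
    (r₂ R (w.2.1 2) (f (w.2.1 2)) : ℂ) * (w.1 : ℂ))

/-- The points of the graph of `f` in the coordinate range. -/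
def graphSet (f : ℝ → ℝ) : Set (ℝ × ℝ) := {p ∈ coordRange | p.2 = f p.1}

section graph

variable {R : ℝ} {f : ℝ → ℝ}

theorem S2_mem_Icc (u : S2) : u.1 2 ∈ Set.Icc (-1 : ℝ) 1 := by
  have := S2_norm_sq u
  exact abs_le.1 (abs_le_one_iff_mul_self_le_one.2 (by 
    nlinarith [sq_nonneg (u.1 0), sq_nonneg (u.1 1)]))

theorem mk_mem_coordRange (hf1 : f (-1) < -1) {x : ℝ} (hx : x ∈ Set.Icc (-1 : ℝ) 1)
    (hle : f x ≤ -1) : (x, f x) ∈ coordRange := by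
  refine ⟨hx.1, hx.2, hle, fun h => ?_⟩
  rw [Prod.mk.injEq] at h
  rw [h.1] at h
  linarith [h.2]

variable (hR : 0 < R) (hf : Continuous f) (hle : ∀ x ∈ Set.Icc (-1 : ℝ) 1, f x ≤ -1)
  (hf1 : f (-1) < -1)

include hle hf1 in
theorem graph_mem (w : Circle × S2) : (w.2.1 2, f (w.2.1 2)) ∈ coordRange :=
  mk_mem_coordRange hf1 (S2_mem_Icc _) (hle _ (S2_mem_Icc _))

include hf hle hf1 in
theorem continuous_graphParam : Continuous (graphParam R f) := by
  have h : ∀ w : Circle × S2, w.2.1 2 - f (w.2.1 2) ≠ 0 := fun w =>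
    (sub_pos_of_mem_coordRange (graph_mem hle hf1 w)).ne'
  unfold graphParam r₂
  refine Continuous.prodMk (Continuous.mul ?_ (continuous_complex_mk (by fun_prop) (by fun_prop)))
    (Continuous.mul ?_ (by fun_prop))
  · exact Complex.continuous_ofReal.comp (Continuous.div (by fun_prop) (by fun_prop) h)
  · exact Complex.continuous_ofReal.comp (Continuous.div (by fun_prop) (by fun_prop) h)

include hR hle hf1 in
theorem norm_graphParam (w : Circle × S2) :
    ‖(graphParam R f w).1‖ = r₁ R (w.2.1 2) (f (w.2.1 2)) ∧
      ‖(graphParam R f w).2‖ = r₂ R (w.2.1 2) (f (w.2.1 2)) := by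
  have hp := graph_mem hle hf1 w
  have h0 := sub_pos_of_mem_coordRange hp
  have h1 := r₂_nonneg hR hp
  simp only at h0 h1
  constructor
  · have hn : ‖(⟨w.2.1 0, w.2.1 1⟩ : ℂ)‖ = √(1 - w.2.1 2 ^ 2) := by
      rw [← sq_eq_sq₀ (norm_nonneg _) (Real.sqrt_nonneg _), norm_complex_sq,
        Real.sq_sqrt (by nlinarith [hp.1, hp.2.1])]
      linarith [S2_norm_sq w.2]
    have h2 : 0 < R / (w.2.1 2 - f (w.2.1 2)) := by positivity
    rw [graphParam, norm_mul, hn, Complex.norm_real, Real.norm_of_nonneg h2.le, r₁]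
    ring
  · rw [graphParam, norm_mul, Circle.norm_coe, Complex.norm_real, Real.norm_of_nonneg h1, mul_one]

-- Equal images have equal radii, hence equal `x`; dividing by the positive factor in the first
-- coordinate recovers the point of the two-sphere. The circle factor is lost only where `r₂ = 0`.
include hR hle hf1 in
theorem graphParam_eq_iff (a b : Circle) (u v : S2) :
    graphParam R f (a, u) = graphParam R f (b, v) ↔ u = v ∧ (a = b ∨ f (u.1 2) = -1) := by
  constructor
  · intro h
    have ha := norm_graphParam hR hle hf1 (a, u)
    have hb := norm_graphParam hR hle hf1 (b, v)
    rw [h] at ha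
    have hp := polar_injOn hR (graph_mem hle hf1 (a, u)) (graph_mem hle hf1 (b, v))
      (ha.1.symm.trans hb.1) (ha.2.symm.trans hb.2)
    have hx : u.1 2 = v.1 2 := congrArg Prod.fst hp
    have h0 := sub_pos_of_mem_coordRange (graph_mem hle hf1 (b, v))
    simp only [graphParam, hx, Prod.mk.injEq] at h h0
    have hc : ((R / (v.1 2 - f (v.1 2)) : ℝ) : ℂ) ≠ 0 := by
      exact_mod_cast (by positivity : 0 < R / (v.1 2 - f (v.1 2))).ne'
    have h1 := mul_left_cancel₀ hc h.1
    rw [Complex.mk.injEq] at h1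
    have huv : u = v := by
      ext i
      fin_cases i
      exacts [h1.1, h1.2, hx]
    refine ⟨huv, ?_⟩
    rw [huv, ← r₂_eq_zero_iff hR (graph_mem hle hf1 (b, v))]
    rcases eq_or_ne (r₂ R (v.1 2) (f (v.1 2))) 0 with hz | hz
    · exact Or.inr hz
    · exact Or.inl (Circle.ext (mul_left_cancel₀ (by exact_mod_cast hz) h.2))
  · rintro ⟨rfl, rfl | h⟩
    · rfl
    · have := (r₂_eq_zero_iff hR (graph_mem hle hf1 (a, u))).2 h
      simp only at this
      simp [graphParam, this]

include hR hle hf1 in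
theorem range_graphParam : Set.range (graphParam R f) = spatial R (graphSet f) := by
  ext z
  constructor
  · rintro ⟨w, rfl⟩
    exact ⟨_, ⟨graph_mem hle hf1 w, rfl⟩, norm_graphParam hR hle hf1 w⟩
  · rintro ⟨⟨x, y⟩, ⟨hp, hy⟩, h1, h2⟩
    simp only at hy h1 h2
    subst hy
    have h0 := sub_pos_of_mem_coordRange hp
    simp only at h0
    set c : ℝ := R / (x - f x) with hc
    have hc0 : 0 < c := by positivity
    have hw : ‖z.1 / (c : ℂ)‖ ^ 2 = 1 - x ^ 2 := by
      rw [norm_div, h1, div_pow, sq_r₁ hp, Complex.norm_real, Real.norm_of_nonneg hc0.le, hc]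
      field_simp
    -- The rescaled first coordinate has squared modulus `1-x²`, so together with `x` it is a unit
    -- vector.
    let u : S2 := ⟨!₂[(z.1 / c).re, (z.1 / c).im, x], by
      rw [mem_sphere_zero_iff_norm, ← sq_eq_sq₀ (norm_nonneg _) zero_le_one,
        EuclideanSpace.norm_sq_eq, Fin.sum_univ_three]
      rw [norm_complex_sq] at hw
      simp only [Real.norm_eq_abs, sq_abs, Matrix.cons_val]
      linarith⟩
    have u2 : u.1 2 = x := by simp [u]
    have u01 : (⟨u.1 0, u.1 1⟩ : ℂ) = z.1 / c := rfl
    refine ⟨(⟨dir z.2, mem_sphere_zero_iff_norm.2 (norm_dir _)⟩, u), Prod.ext ?_ ?_⟩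
    · simp only [graphParam]
      rw [u01, u2]
      exact mul_div_cancel₀ _ (by exact_mod_cast hc0.ne')
    · simp only [graphParam]
      rw [u2, ← h2]
      exact norm_mul_dir _

include hR hf in
/-- A half of a graph which meets the axis `y = -1` exactly at `x = e * x0`, `e = ±1`. -/
theorem nonempty_homeomorph_S3_of_graph {e x0 : ℝ} (he : e ^ 2 = 1) (hx0 : 0 ≤ x0) (hx1 : x0 < 1)
    (hlt : ∀ x ∈ Set.Icc (-1 : ℝ) 1, f x ≤ -1 ↔ x0 ≤ |x|)
    (heq : ∀ x ∈ Set.Icc (-1 : ℝ) 1, f x = -1 ↔ |x| = x0) :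
    Nonempty (spatial R {p ∈ graphSet f | 0 ≤ e * p.1} ≃ₜ S3) := by
  have hf1 : f (-1) < -1 := by
    have hm : (-1 : ℝ) ∈ Set.Icc (-1 : ℝ) 1 := by norm_num
    refine lt_of_le_of_ne ((hlt _ hm).2 (by simpa using hx1.le)) fun h => ?_
    have := (heq _ hm).1 h
    simp at this
    linarith
  have heabs : |e| = 1 := by rw [← abs_one, ← sq_eq_sq_iff_abs_eq_abs]; simpa using he
  -- The parameter runs from the axis point `x = e * x0`, where `r₂ = 0`, to `x = e`, where `r₁ =
  -- 0`.
  let X : ℝ → ℝ := fun s => e * (x0 + (1 - x0) * s)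
  have hXabs : ∀ s ∈ Set.Icc (0 : ℝ) 1, |X s| = x0 + (1 - x0) * s := fun s hs => by
    rw [abs_mul, heabs, one_mul, abs_of_nonneg]
    nlinarith [hs.1]
  have hXm : ∀ s ∈ Set.Icc (0 : ℝ) 1, X s ∈ Set.Icc (-1 : ℝ) 1 := fun s hs => by
    refine abs_le.1 ?_
    rw [hXabs s hs]
    nlinarith [hs.2]
  have hmem : ∀ s ∈ Set.Icc (0 : ℝ) 1, (X s, f (X s)) ∈ coordRange := fun s hs =>
    mk_mem_coordRange hf1 (hXm s hs) ((hlt _ (hXm s hs)).2 (by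
      rw [hXabs s hs]; nlinarith [hs.1]))
  have hXc : Continuous X := by fun_prop
  have hfX : Continuous fun s => f (X s) := hf.comp hXc
  have hne : ∀ s ∈ Set.Icc (0 : ℝ) 1, X s - f (X s) ≠ 0 := fun s hs =>
    (sub_pos_of_mem_coordRange (hmem s hs)).ne'
  have main := nonempty_homeomorph_S3_of_arc (f := fun s => r₁ R (X s) (f (X s)))
    (g := fun s => r₂ R (X s) (f (X s))) ?_ ?_ (fun s hs => r₁_nonneg hR (hmem s hs))
    (fun s hs => r₂_nonneg hR (hmem s hs)) ?_ ?_ ?_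
  · refine (congrArg (fun S : Set (ℂ × ℂ) => Nonempty (S ≃ₜ S3)) ?_).mpr main
    ext z
    constructor
    · rintro ⟨⟨x, y⟩, ⟨⟨hp, hy⟩, hx⟩, h⟩
      simp only at hy hx h
      subst hy
      have hxm : x ∈ Set.Icc (-1 : ℝ) 1 := ⟨hp.1, hp.2.1⟩
      have hax : |x| = e * x := by rw [← abs_of_nonneg hx, abs_mul, heabs, one_mul]
      have h1 := (hlt x hxm).1 hp.2.2.1
      have h2 : |x| ≤ 1 := abs_le.2 hxm
      have h3 : 0 < 1 - x0 := by linarith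
      have hX : X ((|x| - x0) / (1 - x0)) = x := by
        simp only [X]
        rw [mul_div_cancel₀ _ h3.ne', hax]
        linear_combination x * he
      refine ⟨(|x| - x0) / (1 - x0), ⟨div_nonneg (by linarith) h3.le, ?_⟩, ?_⟩
      · rw [div_le_one h3]; linarith
      · rw [hX]; exact h
    · rintro ⟨s, hs, h⟩
      refine ⟨(X s, f (X s)), ⟨⟨hmem s hs, rfl⟩, ?_⟩, h⟩
      have : e * X s = e ^ 2 * (x0 + (1 - x0) * s) := by simp only [X]; ring
      simp only [this, he]
      nlinarith [hs.1]
  · unfold r₁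
    exact ContinuousOn.div (by fun_prop) (by fun_prop) hne
  · unfold r₂
    exact ContinuousOn.div (by fun_prop) (by fun_prop) hne
  · intro s hs
    rw [r₁_eq_zero_iff hR (hmem s hs), ← sq_abs, hXabs s hs]
    constructor
    · intro h
      have h0 : 0 ≤ x0 + (1 - x0) * s := by nlinarith [hs.1]
      have : x0 + (1 - x0) * s = 1 := by nlinarith
      have : (1 - x0) * (s - 1) = 0 := by linarith
      rcases mul_eq_zero.1 this with h | h <;> linarith
    · rintro rfl; ring
  · intro s hs
    rw [r₂_eq_zero_iff hR (hmem s hs), heq _ (hXm s hs), hXabs s hs]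
    constructor
    · intro h
      have : (1 - x0) * s = 0 := by linarith
      rcases mul_eq_zero.1 this with h | h <;> linarith
    · rintro rfl; ring
  · intro s hs t ht h1 h2
    have h := congrArg Prod.fst (polar_injOn hR (hmem s hs) (hmem t ht) h1 h2)
    have h' : |X s| = |X t| := congrArg abs h
    rw [hXabs s hs, hXabs t ht] at h'
    have : (1 - x0) * (s - t) = 0 := by linarith
    rcases mul_eq_zero.1 this with h | h <;> linarith

end graph

/-- Two disjoint three-spheres. -/
theorem nonempty_homeomorph_sum {X Y Z : Type*} [TopologicalSpace X] [TopologicalSpace Y]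
    [TopologicalSpace Z] [CompactSpace X] [CompactSpace Y] [T2Space Z] {S T : Set Z}
    (hST : Disjoint S T) (hS : Nonempty (S ≃ₜ X)) (hT : Nonempty (T ≃ₜ Y)) :
    Nonempty (↥(S ∪ T) ≃ₜ X ⊕ Y) := by
  obtain ⟨a⟩ := hS
  obtain ⟨b⟩ := hT
  refine nonempty_homeomorph_of_range_eq
    (f := Sum.elim (fun x => (a.symm x : Z)) (fun y => (b.symm y : Z))) ?_ ?_ ?_
  · exact Continuous.sumElim (by fun_prop) (by fun_prop)
  · refine Function.Injective.sumElim (Subtype.val_injective.comp a.symm.injective)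
      (Subtype.val_injective.comp b.symm.injective) fun x y h => ?_
    exact Set.disjoint_left.1 hST (a.symm x).2 (h ▸ (b.symm y).2)
  · rw [Set.Sum.elim_range]
    congr 1
    · ext z
      exact ⟨by rintro ⟨x, rfl⟩; exact (a.symm x).2, fun h => ⟨a ⟨z, h⟩, by simp⟩⟩
    · ext z
      exact ⟨by rintro ⟨x, rfl⟩; exact (b.symm x).2, fun h => ⟨b ⟨z, h⟩, by simp⟩⟩

end

end BlackRing

/-! ### Which points the surfaces enclose. -/

namespace BlackRing

noncomputable section

theorem encloses_of_separation {S U V : Set (ℂ × ℂ)} {z : ℂ × ℂ} (hU : IsOpen U) (hV : IsOpen V)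
    (hUV : Disjoint U V) (hS : Sᶜ ⊆ U ∪ V) (hb : Bornology.IsBounded U) (hzS : z ∉ S)
    (hzU : z ∈ U) : Encloses S z := by
  refine ⟨hzS, hb.subset ?_⟩
  refine isPreconnected_connectedComponentIn.subset_left_of_subset_union hU hV hUV
    ((connectedComponentIn_subset _ _).trans hS) ⟨z, mem_connectedComponentIn hzS, hzU⟩

theorem not_encloses_of_isPreconnected {S T : Set (ℂ × ℂ)} {z : ℂ × ℂ} (hT : IsPreconnected T)
    (hTS : T ⊆ Sᶜ) (hz : z ∈ T) (hb : ¬ Bornology.IsBounded T) : ¬ Encloses S z :=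
  fun h => hb (h.2.subset (hT.subset_connectedComponentIn hz hTS))

theorem isBounded_euclNormSq_le (M : ℝ) : Bornology.IsBounded {z | euclNormSq z ≤ M} := by
  refine isBounded_iff_forall_norm_le.2 ⟨M + 1, fun z hz => ?_⟩
  have hz : ‖z.1‖ ^ 2 + ‖z.2‖ ^ 2 ≤ M := hz
  rw [Prod.norm_def]
  refine max_le ?_ ?_
  · nlinarith [sq_nonneg (‖z.1‖ - 1), sq_nonneg ‖z.2‖]
  · nlinarith [sq_nonneg (‖z.2‖ - 1), sq_nonneg ‖z.1‖]

/-- The ring together with the part of the section below the graph of `f`. -/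
def belowGraph (R : ℝ) (f : ℝ → ℝ) : Set (ℂ × ℂ) :=
  {z | ringDenom R z = 0 ∨ ringY R z < f (ringX R z)}

/-- The part of the section above the graph of `f`. -/
def aboveGraph (R : ℝ) (f : ℝ → ℝ) : Set (ℂ × ℂ) :=
  {z | ringDenom R z ≠ 0 ∧ f (ringX R z) < ringY R z}

section graph

variable {R h : ℝ} {f : ℝ → ℝ} {z : ℂ × ℂ}

theorem isOpen_aboveGraph (hf : Continuous f) : IsOpen (aboveGraph R f) := by
  have hc : ContinuousOn (fun z => ringY R z - f (ringX R z)) {z | ringDenom R z ≠ 0} :=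
    (continuousOn_ringY R).sub (hf.comp_continuousOn (continuousOn_ringX R))
  convert hc.isOpen_inter_preimage (isOpen_ringDenom_ne_zero R) (isOpen_Ioi (a := (0 : ℝ))) using 1
  ext z
  simp [aboveGraph]

/-- The coordinates are not continuous at the ring, so a neighbourhood of it is supplied by `y < h`
in division-free form. That region contains the ring and lies below the graph because `h < f`. -/
theorem isOpen_belowGraph (hR : 0 < R) (hf : Continuous f)
    (hfh : ∀ x ∈ Set.Icc (-1 : ℝ) 1, h < f x) : IsOpen (belowGraph R f) := by
  have hc : ContinuousOn (fun z => f (ringX R z) - ringY R z) {z | ringDenom R z ≠ 0} :=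
    (hf.comp_continuousOn (continuousOn_ringX R)).sub (continuousOn_ringY R)
  have h1 := hc.isOpen_inter_preimage (isOpen_ringDenom_ne_zero R) (isOpen_Ioi (a := (0 : ℝ)))
  have h2 : IsOpen {z | ringDenom R z * -h < euclNormSq z + R ^ 2} :=
    isOpen_lt (by fun_prop) (by fun_prop)
  convert h2.union h1 using 1
  ext z
  simp only [belowGraph, Set.mem_ofPred_eq, Set.mem_union, Set.mem_inter_iff, Set.mem_preimage,
    Set.mem_Ioi, sub_pos]
  by_cases hD : ringDenom R z = 0
  · have : 0 < euclNormSq z + R ^ 2 := by nlinarith [euclNormSq_nonneg z]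
    simp [hD, this]
  · have key : ringDenom R z * -h < euclNormSq z + R ^ 2 ↔ ringY R z < h := by
      rw [ringY, div_lt_iff₀ (ringDenom_pos hD)]
      constructor <;> intro h' <;> linarith
    rw [key]
    have := hfh _ (ringX_mem_Icc hD)
    constructor
    · rintro (h' | h')
      · exact absurd h' hD
      · exact Or.inr ⟨hD, h'⟩
    · rintro (h' | h')
      · exact Or.inr (h'.trans this)
      · exact Or.inr h'.2

/-- Far away `x` and `y` both tend to `-1`, so for `f(-1) < c < -1` eventually `f(x) < c ≤ y`. The
terms of the radius bound ensure a positive denominator, `y ≥ c` and `x < -1+δ`; the estimates use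
`S-R² ≤ D ≤ S+R²` for the squared norm `S` and the denominator `D`. -/
theorem isBounded_belowGraph (hR : 0 < R) (hf : Continuous f) (hf1 : f (-1) < -1) :
    Bornology.IsBounded (belowGraph R f) := by
  obtain ⟨c, hc1, hc2⟩ := exists_between hf1
  obtain ⟨δ, hδ, hball⟩ := Metric.eventually_nhds_iff.1
    (hf.continuousAt.eventually_lt_const hc1)
  have hc3 : 0 < -c - 1 := by linarith
  have hR2 : 0 < R ^ 2 := by positivity
  have hA : 0 < R ^ 2 * (1 - c) / (-c - 1) := div_pos (mul_pos hR2 (by linarith)) hc3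
  have hB : 0 < 2 * R ^ 2 / δ := by positivity
  refine (isBounded_euclNormSq_le
    (R ^ 2 + R ^ 2 * (1 - c) / (-c - 1) + 2 * R ^ 2 / δ)).subset fun z hz => ?_
  by_contra hcon
  simp only [Set.mem_ofPred_eq, not_le] at hcon
  set S := euclNormSq z with hS
  have hS1 : R ^ 2 < S := by linarith
  have hS2 : R ^ 2 * (1 - c) < S * (-c - 1) := by
    rw [← div_lt_iff₀ hc3]; linarith
  have hS3 : 2 * R ^ 2 < S * δ := by
    rw [← div_lt_iff₀ hδ]; linarith
  have hDsq := ringDenom_sq R z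
  have hDsq' := ringDenom_sq' R z
  have hDnn := ringDenom_nonneg R z
  have hD1 : S - R ^ 2 ≤ ringDenom R z := by
    refine le_of_sq_le_sq ?_ hDnn
    rw [hDsq]
    have : 0 ≤ 4 * R ^ 2 * ‖z.1‖ ^ 2 := by positivity
    linarith
  have hD2 : ringDenom R z ≤ S + R ^ 2 := by
    refine le_of_sq_le_sq ?_ (by linarith)
    rw [hDsq']
    have : 0 ≤ 4 * R ^ 2 * ‖z.2‖ ^ 2 := by positivity
    linarith
  have hD : 0 < ringDenom R z := by linarith
  have hX : ringX R z < -1 + δ := by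
    rw [ringX, div_lt_iff₀ hD, ← hS]
    nlinarith
  have hY : c ≤ ringY R z := by
    rw [ringY, le_div_iff₀ hD, ← hS]
    nlinarith
  have hX' := (ringX_mem_Icc hD.ne').1
  have hfX : f (ringX R z) < c := hball (by
    rw [Real.dist_eq, abs_lt]; constructor <;> linarith)
  rcases hz with hz | hz
  · exact hD.ne' hz
  · linarith

theorem ringX_pos_iff (hD : ringDenom R z ≠ 0) : 0 < ringX R z ↔ euclNormSq z < R ^ 2 := by
  rw [ringX, lt_div_iff₀ (ringDenom_pos hD), zero_mul, sub_pos]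

theorem ringX_neg_iff (hD : ringDenom R z ≠ 0) : ringX R z < 0 ↔ R ^ 2 < euclNormSq z := by
  rw [ringX, div_lt_iff₀ (ringDenom_pos hD), zero_mul, sub_neg]

theorem mem_spatial_graphSet_iff (hR : 0 < R) (P : ℝ → Prop) :
    z ∈ spatial R {p ∈ graphSet f | P p.1} ↔
      ringDenom R z ≠ 0 ∧ ringY R z = f (ringX R z) ∧ P (ringX R z) := by
  rw [mem_spatial_iff hR fun p hp => hp.1.1]
  constructor
  · rintro ⟨hD, ⟨-, h2⟩, h3⟩
    exact ⟨hD, h2, h3⟩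
  · rintro ⟨hD, h2, h3⟩
    exact ⟨hD, ⟨ringXY_mem_coordRange hR hD, h2⟩, h3⟩

theorem mem_horizon_iff {lam nu : ℝ} (hR : 0 < R) :
    z ∈ horizon R lam nu ↔ ringDenom R z ≠ 0 ∧ ringY R z = horizonY lam nu := by
  rw [horizon, mem_spatial_iff hR fun p hp => hp.1]
  exact and_congr_right fun hD => ⟨fun h => h.2, fun h => ⟨ringXY_mem_coordRange hR hD, h⟩⟩

theorem mem_belowGraph_of_horizon (hfh : ∀ x ∈ Set.Icc (-1 : ℝ) 1, h < f x)
    (hD : ringDenom R z ≠ 0) (hy : ringY R z = h) : z ∈ belowGraph R f :=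
  Or.inr (by rw [hy]; exact hfh _ (ringX_mem_Icc hD))

theorem disjoint_below_above : Disjoint (belowGraph R f) (aboveGraph R f) := by
  rw [Set.disjoint_left]
  rintro z (h1 | h1) ⟨h2, h3⟩
  · exact h2 h1
  · exact lt_asymm h1 h3

theorem encloses_graph (hR : 0 < R) (hf : Continuous f) (hf1 : f (-1) < -1)
    (hfh : ∀ x ∈ Set.Icc (-1 : ℝ) 1, h < f x) (hD : ringDenom R z ≠ 0) (hy : ringY R z = h) :
    Encloses (spatial R (graphSet f)) z := by
  have hmem : ∀ z, z ∈ spatial R (graphSet f) ↔ ringDenom R z ≠ 0 ∧ ringY R z = f (ringX R z) :=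
    fun z => by simpa using mem_spatial_graphSet_iff (z := z) (f := f) hR fun _ => True
  refine encloses_of_separation (isOpen_belowGraph hR hf hfh) (isOpen_aboveGraph hf)
    disjoint_below_above (fun w hw => ?_) (isBounded_belowGraph hR hf hf1) ?_
    (mem_belowGraph_of_horizon hfh hD hy)
  · rw [Set.mem_compl_iff, hmem] at hw
    by_cases hDw : ringDenom R w = 0
    · exact Or.inl (Or.inl hDw)
    · rcases lt_trichotomy (ringY R w) (f (ringX R w)) with h1 | h1 | h1
      · exact Or.inl (Or.inr h1)
      · exact absurd ⟨hDw, h1⟩ hw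
      · exact Or.inr ⟨hDw, h1⟩
  · rw [hmem, hy]
    exact fun h' => (hfh _ (ringX_mem_Icc hD)).ne h'.2

theorem ringY_lt_of_euclNormSq_eq (hf0 : -1 < f 0) (hD : ringDenom R z ≠ 0)
    (hz : euclNormSq z = R ^ 2) : ringY R z < f (ringX R z) := by
  have hx : ringX R z = 0 := by rw [ringX, hz, sub_self, zero_div]
  rw [hx]
  exact (ringY_le hD).trans_lt hf0

/-- Filling in the open ball `r₁² + r₂² < R²` discards the inner half. The boundary sphere needs no
separate treatment, since by `-1 < f 0` it lies below the graph. -/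
theorem encloses_outer (hR : 0 < R) (hf : Continuous f) (hf1 : f (-1) < -1) (hf0 : -1 < f 0)
    (hfh : ∀ x ∈ Set.Icc (-1 : ℝ) 1, h < f x) (hD : ringDenom R z ≠ 0) (hy : ringY R z = h) :
    Encloses (spatial R {p ∈ graphSet f | p.1 ≤ 0}) z := by
  have hmem : ∀ z, z ∈ spatial R {p ∈ graphSet f | p.1 ≤ 0} ↔ _ :=
    fun z => mem_spatial_graphSet_iff (z := z) (f := f) hR (· ≤ 0)
  refine encloses_of_separation
    (U := belowGraph R f ∪ {w | euclNormSq w < R ^ 2})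
    (V := aboveGraph R f ∩ {w | R ^ 2 < euclNormSq w})
    ((isOpen_belowGraph hR hf hfh).union (isOpen_lt (by fun_prop) (by fun_prop)))
    ((isOpen_aboveGraph hf).inter (isOpen_lt (by fun_prop) (by fun_prop)))
    ?_ (fun w hw => ?_) ((isBounded_belowGraph hR hf hf1).union
      ((isBounded_euclNormSq_le (R ^ 2)).subset fun w hw => show euclNormSq w ≤ R ^ 2 from le_of_lt hw)) ?_
    (Or.inl (mem_belowGraph_of_horizon hfh hD hy))
  · rw [Set.disjoint_left]
    rintro w (h1 | h1) ⟨h2, h3⟩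
    · exact Set.disjoint_left.1 disjoint_below_above h1 h2
    · rw [Set.mem_ofPred_eq] at h1 h3
      exact lt_asymm h1 h3
  · rw [Set.mem_compl_iff, hmem] at hw
    by_cases hDw : ringDenom R w = 0
    · exact Or.inl (Or.inl (Or.inl hDw))
    rcases lt_trichotomy (euclNormSq w) (R ^ 2) with h1 | h1 | h1
    · exact Or.inl (Or.inr h1)
    · exact Or.inl (Or.inl (Or.inr (ringY_lt_of_euclNormSq_eq hf0 hDw h1)))
    · rcases lt_trichotomy (ringY R w) (f (ringX R w)) with h2 | h2 | h2
      · exact Or.inl (Or.inl (Or.inr h2))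
      · exact absurd ⟨hDw, h2, ((ringX_neg_iff hDw).2 h1).le⟩ hw
      · exact Or.inr ⟨⟨hDw, h2⟩, h1⟩
  · rw [hmem, hy]
    exact fun h' => (hfh _ (ringX_mem_Icc hD)).ne h'.2.1

/-- The centre has `x = 1`, `y = -1` and lies above the graph since `f 1 < -1`. The part of the ball
above the graph is cut off, because the bounding sphere lies below the graph. -/
theorem encloses_inner_zero (hR : 0 < R) (hf : Continuous f) (hf1 : f 1 < -1) (hf0 : -1 < f 0)
    (hfh : ∀ x ∈ Set.Icc (-1 : ℝ) 1, h < f x) :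
    Encloses (spatial R {p ∈ graphSet f | 0 ≤ p.1}) 0 := by
  have hmem : ∀ z, z ∈ spatial R {p ∈ graphSet f | 0 ≤ p.1} ↔ _ :=
    fun z => mem_spatial_graphSet_iff (z := z) (f := f) hR (0 ≤ ·)
  have hS0 : euclNormSq 0 = 0 := by simp [euclNormSq]
  have hD0 : ringDenom R 0 = R ^ 2 := by
    rw [ringDenom, hS0, Prod.fst_zero, norm_zero, zero_sub, zero_pow two_ne_zero, mul_zero,
      add_zero, neg_sq, Real.sqrt_sq (by positivity)]
  have hR2 : R ^ 2 ≠ 0 := by positivity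
  have hX0 : ringX R 0 = 1 := by rw [ringX, hS0, hD0, sub_zero, div_self hR2]
  have hY0 : ringY R 0 = -1 := by rw [ringY, hS0, hD0, zero_add, neg_div, div_self hR2]
  refine encloses_of_separation
    (U := aboveGraph R f ∩ {w | euclNormSq w < R ^ 2})
    (V := belowGraph R f ∪ {w | R ^ 2 < euclNormSq w})
    ((isOpen_aboveGraph hf).inter (isOpen_lt (by fun_prop) (by fun_prop)))
    ((isOpen_belowGraph hR hf hfh).union (isOpen_lt (by fun_prop) (by fun_prop)))
    ?_ (fun w hw => ?_) ((isBounded_euclNormSq_le (R ^ 2)).subset fun w hw => show euclNormSq w ≤ R ^ 2 from le_of_lt hw.2) ?_ ?_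
  · rw [Set.disjoint_left]
    rintro w ⟨h2, h3⟩ (h1 | h1)
    · exact Set.disjoint_left.1 disjoint_below_above h1 h2
    · rw [Set.mem_ofPred_eq] at h1 h3
      exact lt_asymm h1 h3
  · rw [Set.mem_compl_iff, hmem] at hw
    by_cases hDw : ringDenom R w = 0
    · exact Or.inr (Or.inl (Or.inl hDw))
    rcases lt_trichotomy (euclNormSq w) (R ^ 2) with h1 | h1 | h1
    · rcases lt_trichotomy (ringY R w) (f (ringX R w)) with h2 | h2 | h2
      · exact Or.inr (Or.inl (Or.inr h2))
      · exact absurd ⟨hDw, h2, ((ringX_pos_iff hDw).2 h1).le⟩ hw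
      · exact Or.inl ⟨⟨hDw, h2⟩, h1⟩
    · exact Or.inr (Or.inl (Or.inr (ringY_lt_of_euclNormSq_eq hf0 hDw h1)))
    · exact Or.inr (Or.inr h1)
  · rw [hmem, hX0, hY0]
    exact fun h' => hf1.ne' h'.2.1
  · refine ⟨⟨by rwa [hD0], by rwa [hX0, hY0]⟩, ?_⟩
    rw [Set.mem_ofPred_eq, hS0]
    positivity

/-- An escape route: at fixed angles along `y = h < f` to `x = -1`, then radially outwards. The
radial part stays in `x < 0`, off the inner half. -/
theorem not_encloses_inner (hR : 0 < R) (hh : h < -1)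
    (hfh : ∀ x ∈ Set.Icc (-1 : ℝ) 1, h < f x) (hD : ringDenom R z ≠ 0) (hy : ringY R z = h) :
    ¬ Encloses (spatial R {p ∈ graphSet f | 0 ≤ p.1}) z := by
  have hmem : ∀ z, z ∈ spatial R {p ∈ graphSet f | 0 ≤ p.1} ↔ _ :=
    fun z => mem_spatial_graphSet_iff (z := z) (f := f) hR (0 ≤ ·)
  have hXm := ringX_mem_Icc hD
  let γ : ℝ → ℂ × ℂ := fun s => ((r₁ R s h : ℂ) * dir z.1, (r₂ R s h : ℂ) * dir z.2)
  have hcr : ∀ s ∈ Set.Icc (-1) (ringX R z), (s, h) ∈ coordRange := fun s hs =>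
    ⟨hs.1, hs.2.trans hXm.2, hh.le, fun h' => hh.ne (congrArg Prod.snd h')⟩
  have hγ : ∀ s ∈ Set.Icc (-1) (ringX R z),
      ringDenom R (γ s) ≠ 0 ∧ (ringX R (γ s), ringY R (γ s)) = (s, h) := fun s hs => by
    have n1 := r₁_nonneg hR (hcr s hs)
    have n2 := r₂_nonneg hR (hcr s hs)
    refine (norm_eq_polar_iff hR (hcr s hs)).1 ⟨?_, ?_⟩
    · simp only at n1
      simp [γ, abs_of_nonneg n1]
    · simp only at n2
      simp [γ, abs_of_nonneg n2]
  have hγc : ContinuousOn γ (Set.Icc (-1) (ringX R z)) := by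
    have hne : ∀ s ∈ Set.Icc (-1) (ringX R z), s - h ≠ 0 := fun s hs =>
      (sub_pos_of_mem_coordRange (hcr s hs)).ne'
    refine ContinuousOn.prodMk (ContinuousOn.mul ?_ continuousOn_const)
      (ContinuousOn.mul ?_ continuousOn_const)
    · refine Complex.continuous_ofReal.comp_continuousOn ?_
      unfold r₁
      exact ContinuousOn.div (by fun_prop) (by fun_prop) hne
    · refine Complex.continuous_ofReal.comp_continuousOn ?_
      unfold r₂
      exact ContinuousOn.div (by fun_prop) (by fun_prop) hne
  have hl : (-1 : ℝ) ∈ Set.Icc (-1) (ringX R z) := ⟨le_rfl, hXm.1⟩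
  have hr : ringX R z ∈ Set.Icc (-1) (ringX R z) := ⟨hXm.1, le_rfl⟩
  have hγz : γ (ringX R z) = z := by
    obtain ⟨e1, e2⟩ := (norm_eq_polar_iff hR (hcr _ hr)).2 ⟨hD, by rw [hy]⟩
    simp only at e1 e2
    simp only [γ, ← e1, ← e2, norm_mul_dir]
  set w := γ (-1) with hw
  obtain ⟨hDw, hXw⟩ := hγ _ hl
  have hSw : R ^ 2 < euclNormSq w := by
    rw [Prod.mk.injEq] at hXw
    rw [hw, ← ringX_neg_iff hDw, hXw.1]
    norm_num
  let ray : Set (ℂ × ℂ) := (fun t : ℝ => t • w) '' Set.Ici 1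
  have hray : ∀ u ∈ ray, R ^ 2 < euclNormSq u := by
    rintro _ ⟨t, ht, rfl⟩
    have ht : 1 ≤ t := ht
    have e : euclNormSq (t • w) = t ^ 2 * euclNormSq w := by
      simp only [euclNormSq, Prod.smul_fst, Prod.smul_snd, norm_smul, mul_pow, Real.norm_eq_abs,
        sq_abs]
      ring
    rw [e]
    nlinarith [one_le_pow₀ ht (n := 2), euclNormSq_nonneg w]
  refine not_encloses_of_isPreconnected (T := γ '' Set.Icc (-1) (ringX R z) ∪ ray) ?_ ?_
    (Or.inl ⟨_, hr, hγz⟩) ?_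
  · refine IsPreconnected.union w ⟨_, hl, rfl⟩ ⟨1, Set.self_mem_Ici, one_smul _ _⟩
      (isPreconnected_Icc.image _ hγc) (isPreconnected_Ici.image _ (by fun_prop))
  · rintro u (⟨s, hs, rfl⟩ | hu)
    · obtain ⟨hDs, hXs⟩ := hγ s hs
      rw [Prod.mk.injEq] at hXs
      rw [Set.mem_compl_iff, hmem, hXs.1, hXs.2]
      exact fun h' => (hfh s ⟨hs.1, hs.2.trans hXm.2⟩).ne h'.2.1
    · rw [Set.mem_compl_iff, hmem]
      exact fun h' => absurd ((ringX_neg_iff h'.1).2 (hray u hu)) (not_lt.2 h'.2.2)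
  · intro hb
    obtain ⟨C, hC⟩ := isBounded_iff_forall_norm_le.1 (hb.subset Set.subset_union_right)
    have hw0 : 0 < ‖w‖ := by
      rw [norm_pos_iff]
      rintro h0
      rw [h0] at hSw
      simp only [euclNormSq, Prod.fst_zero, Prod.snd_zero, norm_zero] at hSw
      nlinarith
    -- This multiple of `w` lies on the ray and has norm at least `C + ‖w‖`, exceeding the supposed
    -- bound `C`.
    have h1 := hC _ ⟨max 1 (C / ‖w‖ + 1), Set.mem_Ici.2 (le_max_left _ _), rfl⟩
    have h2 := le_max_right 1 (C / ‖w‖ + 1)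
    simp only [norm_smul, Real.norm_eq_abs] at h1
    have h3 : C / ‖w‖ + 1 ≤ |max 1 (C / ‖w‖ + 1)| := h2.trans (le_abs_self _)
    have h4 := mul_le_mul_of_nonneg_right h3 hw0.le
    rw [add_mul, div_mul_cancel₀ _ hw0.ne'] at h4
    linarith

end graph

end

end BlackRing

/-! ### The axis zeros of `H` and the assembly of the cases. -/

namespace BlackRing

/-- Locates the axis crossings `x = ±x0` for the critical and fast cases together. Here `ν = 0` is
impossible, as it would force `1 ≤ λ < 1`; and `x0 < 1` because `ν(1+λ-ν) - (λ+ν-1) = (1-ν)(1+ν-λ) >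
0`. -/
theorem exists_H_neg_one_eq {lam nu : ℝ} (hnu0 : 0 ≤ nu) (hnu1 : nu < 1) (h2 : lam < 1 + nu)
    (h3 : 1 - nu ≤ lam) :
    ∃ c x0 : ℝ, 0 < c ∧ 0 ≤ x0 ∧ x0 < 1 ∧ (x0 = 0 ↔ lam = 1 - nu) ∧
      ∀ x, H lam nu (-1) x = c * (x ^ 2 - x0 ^ 2) := by
  have hnu : 0 < nu := by
    rcases hnu0.eq_or_lt with h | h
    · linarith
    · exact h
  have hK : 0 < nu * (1 + lam - nu) := mul_pos hnu (by linarith)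
  have hq : 0 ≤ (lam + nu - 1) / (nu * (1 + lam - nu)) := div_nonneg (by linarith) hK.le
  refine ⟨(1 + nu - lam) * (nu * (1 + lam - nu)), √((lam + nu - 1) / (nu * (1 + lam - nu))),
    mul_pos (by linarith) hK, Real.sqrt_nonneg _, ?_, ?_, fun x => ?_⟩
  · rw [Real.sqrt_lt' one_pos, one_pow, div_lt_one hK]
    nlinarith
  · rw [Real.sqrt_eq_zero hq, div_eq_zero_iff, or_iff_left hK.ne']
    constructor <;> intro h <;> linarith
  · have e : nu * (1 + lam - nu) * ((lam + nu - 1) / (nu * (1 + lam - nu))) = lam + nu - 1 :=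
      mul_div_cancel₀ _ hK.ne'
    rw [Real.sq_sqrt hq, H_neg_one]
    linear_combination (1 + nu - lam) * e

end BlackRing

open BlackRing in
theorem mainTheorem5 (R lam nu : ℝ) (hR : 0 < R) (hnu0 : 0 ≤ nu) (hnu1 : nu < 1)
    (hlam0 : 0 < lam) (hlam1 : 2 * √nu ≤ lam) (hlam2 : lam < 1 + nu) :
    -- the ergosurface is a graph `y = y_e(x)` with `y_e(x) > y_h`, and it surrounds the horizon
    (∃ ye : ℝ → ℝ, ContinuousOn ye (Set.Icc (-1) 1) ∧
      ∀ x ∈ Set.Icc (-1 : ℝ) 1,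
        horizonY lam nu < ye x ∧ H lam nu (ye x) x = 0 ∧
        ∀ y ∈ Set.Icc (horizonY lam nu) (-1),
          (H lam nu y x < 0 ↔ y < ye x) ∧ (H lam nu y x = 0 ↔ y = ye x)) ∧
    (∀ z ∈ horizon R lam nu, Encloses (ergosurface R lam nu) z) ∧
    -- the ends of the axis `y = -1` are always outside the ergoregion
    0 < H lam nu (-1) 1 ∧ 0 < H lam nu (-1) (-1) ∧
    -- slow rotation of the two-sphere
    (lam < 1 - nu →
      (∀ x ∈ Set.Icc (-1 : ℝ) 1, 0 < H lam nu (-1) x) ∧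
      Nonempty (ergosurface R lam nu ≃ₜ Circle × S2)) ∧
    -- fast rotation of the two-sphere
    (1 - nu < lam →
      (∃ x ∈ Set.Icc (-1 : ℝ) 1, H lam nu (-1) x < 0) ∧
      Nonempty (ergosurface R lam nu ≃ₜ S3 ⊕ S3) ∧
      ergosurface R lam nu = innerErgosurface R lam nu ∪ outerErgosurface R lam nu ∧
      Disjoint (innerErgosurface R lam nu) (outerErgosurface R lam nu) ∧
      Nonempty (innerErgosurface R lam nu ≃ₜ S3) ∧
      Nonempty (outerErgosurface R lam nu ≃ₜ S3) ∧
      Encloses (innerErgosurface R lam nu) 0 ∧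
      ∀ z ∈ horizon R lam nu,
        ¬ Encloses (innerErgosurface R lam nu) z ∧ Encloses (outerErgosurface R lam nu) z) ∧
    -- the critical case: the surface pinches on the circle `x = 0`, `y = -1`
    (lam = 1 - nu →
      ergosurface R lam nu ∩ {z | z.2 = 0} = spatial R {(0, -1)} ∧
      spatial R {(0, -1)} = {z | ‖z.1‖ = R ∧ z.2 = 0} ∧
      (∃ q : Circle × S2 → ℂ × ℂ, Continuous q ∧ Set.range q = ergosurface R lam nu ∧
        (∀ a b : Circle, ∀ u v : S2,
          q (a, u) = q (b, v) ↔ u = v ∧ (a = b ∨ u.1 2 = 0)) ∧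
        ∀ (a : Circle) (u : S2), q (a, u) ∈ spatial R {(0, -1)} ↔ u.1 2 = 0) ∧
      ergosurface R lam nu = innerErgosurface R lam nu ∪ outerErgosurface R lam nu ∧
      innerErgosurface R lam nu ∩ outerErgosurface R lam nu = spatial R {(0, -1)} ∧
      Nonempty (innerErgosurface R lam nu ≃ₜ S3) ∧
      Nonempty (outerErgosurface R lam nu ≃ₜ S3)) := by
  obtain ⟨ye, hyc, hye⟩ := exists_continuous_root hnu0 hnu1 hlam0 hlam1 hlam2
  have hh := horizonY_lt_neg_one hnu1 hlam0 hlam2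
  have hfh : ∀ x ∈ Set.Icc (-1 : ℝ) 1, horizonY lam nu < ye x := fun x hx => (hye x hx).1
  have hm : (-1 : ℝ) ∈ Set.Icc (horizonY lam nu) 0 := ⟨hh.le, by norm_num⟩
  have hHlt : ∀ x ∈ Set.Icc (-1 : ℝ) 1, H lam nu (-1) x < 0 ↔ -1 < ye x := fun x hx =>
    ((hye x hx).2.2 _ hm).1
  have hHeq : ∀ x ∈ Set.Icc (-1 : ℝ) 1, H lam nu (-1) x = 0 ↔ ye x = -1 := fun x hx => by
    rw [eq_comm (a := ye x)]
    exact ((hye x hx).2.2 _ hm).2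
  have hHgt : ∀ x ∈ Set.Icc (-1 : ℝ) 1, 0 < H lam nu (-1) x ↔ ye x < -1 := fun x hx => by
    rw [← not_le, ← not_le, le_iff_lt_or_eq, le_iff_lt_or_eq, hHlt x hx, hHeq x hx,
      eq_comm (a := ye x)]
  have hl : (-1 : ℝ) ∈ Set.Icc (-1 : ℝ) 1 := by norm_num
  have hr : (1 : ℝ) ∈ Set.Icc (-1 : ℝ) 1 := by norm_num
  have h0 : (0 : ℝ) ∈ Set.Icc (-1 : ℝ) 1 := by norm_num
  have hp1 : 0 < H lam nu (-1) 1 := H_neg_one_left_pos hnu1 hlam2 (by norm_num)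
  have hp2 : 0 < H lam nu (-1) (-1) := H_neg_one_left_pos hnu1 hlam2 (by norm_num)
  have hye1 := (hHgt _ hr).1 hp1
  have hye2 := (hHgt _ hl).1 hp2
  have hcurve : ergoCurve lam nu = graphSet ye := by
    ext p
    refine and_congr_right fun hp => ?_
    have hx : p.1 ∈ Set.Icc (-1 : ℝ) 1 := ⟨hp.1, hp.2.1⟩
    have hy0 : p.2 ≤ 0 := hp.2.2.1.trans (by norm_num)
    constructor
    · rintro ⟨h1, h2⟩
      exact ((hye _ hx).2.2 _ ⟨h1, hy0⟩).2.1 h2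
    · intro h
      have h1 : horizonY lam nu ≤ p.2 := by rw [h]; exact (hfh _ hx).le
      exact ⟨h1, ((hye _ hx).2.2 _ ⟨h1, hy0⟩).2.2 h⟩
  have hunion : ergosurface R lam nu = innerErgosurface R lam nu ∪ outerErgosurface R lam nu := by
    ext z
    constructor
    · rintro ⟨p, hp, h⟩
      exact (le_total 0 p.1).imp (fun h' => ⟨p, ⟨hp, h'⟩, h⟩) (fun h' => ⟨p, ⟨hp, h'⟩, h⟩)
    · rintro (⟨p, hp, h⟩ | ⟨p, hp, h⟩) <;> exact ⟨p, hp.1, h⟩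
  have hinner : innerErgosurface R lam nu = spatial R {p ∈ graphSet ye | 0 ≤ p.1} := by
    rw [innerErgosurface, hcurve]
  have houter : outerErgosurface R lam nu = spatial R {p ∈ graphSet ye | p.1 ≤ 0} := by
    rw [outerErgosurface, hcurve]
  -- The halves can meet only at `x = 0`, `y = ye 0`: nowhere if `ye 0 > -1`, and on the circle `C`
  -- if `ye 0 = -1`.
  have hinter : innerErgosurface R lam nu ∩ outerErgosurface R lam nu
      = {z | ringDenom R z ≠ 0 ∧ ringY R z = ye 0 ∧ ringX R z = 0} := by
    ext z
    rw [hinner, houter, Set.mem_inter_iff, mem_spatial_graphSet_iff hR (0 ≤ ·),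
      mem_spatial_graphSet_iff hR (· ≤ 0)]
    constructor
    · rintro ⟨⟨h1, h2, h3⟩, -, -, h4⟩
      have h5 := le_antisymm h4 h3
      exact ⟨h1, h5 ▸ h2, h5⟩
    · rintro ⟨h1, h2, h3⟩
      have h4 : ringY R z = ye (ringX R z) := by rw [h3, h2]
      exact ⟨⟨h1, h4, h3.ge⟩, h1, h4, h3.le⟩
  have hspheres : 1 - nu ≤ lam → Nonempty (innerErgosurface R lam nu ≃ₜ S3) ∧
      Nonempty (outerErgosurface R lam nu ≃ₜ S3) := fun h => by
    obtain ⟨c, x0, hc, hx0, hx1, -, hH⟩ := exists_H_neg_one_eq hnu0 hnu1 hlam2 h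
    have heq : ∀ x ∈ Set.Icc (-1 : ℝ) 1, ye x = -1 ↔ |x| = x0 := fun x hx => by
      rw [← hHeq x hx, hH, mul_eq_zero, or_iff_right hc.ne', sub_eq_zero, ← sq_abs,
        sq_eq_sq₀ (abs_nonneg x) hx0]
    have hlt : ∀ x ∈ Set.Icc (-1 : ℝ) 1, ye x ≤ -1 ↔ x0 ≤ |x| := fun x hx => by
      rw [← not_lt, ← hHlt x hx, hH, not_lt, mul_nonneg_iff_of_pos_left hc, sub_nonneg, ← sq_abs x,
        sq_le_sq₀ hx0 (abs_nonneg x)]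
    rw [hinner, houter]
    constructor
    · have hs : {p ∈ graphSet ye | 0 ≤ p.1} = {p ∈ graphSet ye | 0 ≤ 1 * p.1} := by
        simp only [one_mul]
      rw [hs]
      exact nonempty_homeomorph_S3_of_graph hR hyc (by norm_num) hx0 hx1 hlt heq
    · have hs : {p ∈ graphSet ye | p.1 ≤ 0} = {p ∈ graphSet ye | 0 ≤ -1 * p.1} := by
        simp only [neg_one_mul, neg_nonneg]
      rw [hs]
      exact nonempty_homeomorph_S3_of_graph hR hyc (by norm_num) hx0 hx1 hlt heq
  refine ⟨⟨ye, hyc.continuousOn, fun x hx => ?_⟩, fun z hz => ?_, hp1, hp2, fun hlt => ?_,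
    fun hgt => ?_, fun heq => ?_⟩
  · obtain ⟨k1, k2, k3⟩ := hye x hx
    exact ⟨k1, (k3 _ ⟨k1.le, k2.le⟩).2.2 rfl, fun y hy => k3 y ⟨hy.1, hy.2.trans (by norm_num)⟩⟩
  · rw [mem_horizon_iff hR] at hz
    rw [ergosurface, hcurve]
    exact encloses_graph hR hyc hye2 hfh hz.1 hz.2
  · have hpos : ∀ x ∈ Set.Icc (-1 : ℝ) 1, 0 < H lam nu (-1) x := fun x _ => by
      rw [H_neg_one]
      have k1 : 0 < 1 + nu - lam := by linarith
      have k2 : 0 < 1 - lam - nu := by linarith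
      have k3 : 0 < 1 + lam - nu := by linarith
      positivity
    refine ⟨hpos, ?_⟩
    have hle : ∀ x ∈ Set.Icc (-1 : ℝ) 1, ye x ≤ -1 := fun x hx => ((hHgt x hx).1 (hpos x hx)).le
    rw [ergosurface, hcurve]
    refine nonempty_homeomorph_of_range_eq (continuous_graphParam hyc hle hye2) ?_
      (range_graphParam hR hle hye2)
    rintro ⟨a, u⟩ ⟨b, v⟩ h
    obtain ⟨rfl, h | h⟩ := (graphParam_eq_iff hR hle hye2 a b u v).1 h
    · rw [h]
    · exact absurd h ((hHgt _ (S2_mem_Icc u)).1 (hpos _ (S2_mem_Icc u))).ne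
  · have hneg : H lam nu (-1) 0 < 0 := by
      rw [H_neg_one]
      nlinarith
    have hye0 := (hHlt _ h0).1 hneg
    have hdisj : Disjoint (innerErgosurface R lam nu) (outerErgosurface R lam nu) := by
      rw [Set.disjoint_iff_inter_eq_empty, hinter, Set.eq_empty_iff_forall_notMem]
      rintro z ⟨k1, k2, -⟩
      linarith [ringY_le k1]
    obtain ⟨hi, ho⟩ := hspheres hgt.le
    refine ⟨⟨0, h0, hneg⟩, ?_, hunion, hdisj, hi, ho, ?_, fun z hz => ?_⟩
    · rw [hunion]
      exact nonempty_homeomorph_sum hdisj hi ho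
    · rw [hinner]
      exact encloses_inner_zero hR hyc hye1 hye0 hfh
    · rw [mem_horizon_iff hR] at hz
      rw [hinner, houter]
      exact ⟨not_encloses_inner hR hh hfh hz.1 hz.2,
        encloses_outer hR hyc hye2 hye0 hfh hz.1 hz.2⟩
  · obtain ⟨c, x0, hc, -, -, hx0, hH⟩ := exists_H_neg_one_eq hnu0 hnu1 hlam2 heq.ge
    rw [hx0.2 heq] at hH
    have hyeq : ∀ x ∈ Set.Icc (-1 : ℝ) 1, ye x = -1 ↔ x = 0 := fun x hx => by
      rw [← hHeq x hx, hH, mul_eq_zero, or_iff_right hc.ne']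
      simp
    have hle : ∀ x ∈ Set.Icc (-1 : ℝ) 1, ye x ≤ -1 := fun x hx => by
      rw [← not_lt, ← hHlt x hx, hH, not_lt]
      have := sq_nonneg x
      nlinarith
    have hC : ∀ z, z ∈ spatial R {(0, -1)} ↔
        ringDenom R z ≠ 0 ∧ ringX R z = 0 ∧ ringY R z = -1 := fun z => by
      rw [mem_spatial_iff hR]
      · simp
      · rintro _ rfl
        exact ⟨by norm_num, by norm_num, le_rfl, by norm_num⟩
    have hE : ∀ z, z ∈ ergosurface R lam nu ↔
        ringDenom R z ≠ 0 ∧ ringY R z = ye (ringX R z) := fun z => by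
      rw [ergosurface, hcurve]
      simpa using mem_spatial_graphSet_iff (z := z) (f := ye) hR fun _ => True
    refine ⟨?_, ?_, ⟨graphParam R ye, continuous_graphParam hyc hle hye2, ?_, ?_, ?_⟩, hunion, ?_,
      hspheres heq.ge⟩
    · ext z
      rw [Set.mem_inter_iff, hC, hE]
      constructor
      · rintro ⟨⟨k1, k2⟩, k3⟩
        have k3 : z.2 = 0 := k3
        have k4 : ringY R z = -1 := by
          have := ringY_sq_sub_one k1
          rw [k3, norm_zero, mul_zero, zero_div] at this
          nlinarith [ringY_le k1]
        exact ⟨k1, (hyeq _ (ringX_mem_Icc k1)).1 (k2 ▸ k4), k4⟩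
      · rintro ⟨k1, k2, k3⟩
        refine ⟨⟨k1, by rw [k3, (hyeq _ (ringX_mem_Icc k1)).2 k2]⟩, ?_⟩
        have := ringY_sq_sub_one k1
        rw [k3] at this
        have k4 : 2 * R * ‖z.2‖ / ringDenom R z = 0 := by
          rw [← sq_eq_zero_iff]; linarith
        simpa [hR.ne', k1] using k4
    · ext z
      simp [spatial, r₁, r₂]
    · rw [ergosurface, hcurve]
      exact range_graphParam hR hle hye2
    · intro a b u v
      rw [graphParam_eq_iff hR hle hye2, hyeq _ (S2_mem_Icc u)]
    · intro a u
      have k1 := (norm_eq_polar_iff hR (graph_mem hle hye2 (a, u))).1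
        (norm_graphParam hR hle hye2 (a, u))
      have k2 := k1.2
      rw [Prod.mk.injEq] at k2
      rw [hC, k2.1, k2.2]
      exact ⟨fun h => h.2.1, fun h => ⟨k1.1, h, (hyeq _ (S2_mem_Icc u)).2 h⟩⟩
    · ext z
      rw [hinter, hC, (hyeq _ h0).2 rfl]
      exact and_congr_right fun _ => and_comm
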